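/- Notation. Let $\Pi=\{x+iy\in\mathbb C : y>0\}$ and write $(a)_n=a(a+1)\cdots(a+n-1)$. For $\lambda>1$ let $H^2_\lambda(\Pi)$ be the Hilbert space of holomorphic functions on $\Pi$ that are square integrable against $y^{\lambda-2}\,dx\,dy$, and for $\lambda',\lambda''>1$ let $H^2_{\lambda',\lambda''}(\Pi\times\Pi)$ be the Hilbert space of holomorphic functions on $\Pi\times\Pi$ that are square integrable against $y_1^{\lambda'-2}y_2^{\lambda''-2}\,dx_1dy_1dx_2dy_2$, which realizes the Hilbert tensor product $H^2_{\lambda'}(\Pi)\hat\otimes H^2_{\lambda''}(\Pi)$. Theorem. Let $\lambda',\lambda'',\lambda'''>1$ be real numbers such that $l=\tfrac12(\lambda'''-\lambda'-\lambda'')$ is a natural number ($l=0$ allowed). The Rankin–Cohen operator $$RC_{\lambda',\lambda''}^{\lambda'''}f(z)=\sum_{j=0}^{l}\frac{(-1)^j(\lambda'+l-j)_j(\lambda''+j)_{l-j}}{j!\,(l-j)!}\,\frac{\partial^l f}{\partial z_1^{l-j}\partial z_2^{j}}(z,z)\qquad(z\in\Pi)$$ is a bounded linear operator $H^2_{\lambda',\lambda''}(\Pi\times\Pi)\to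 H^2_{\lambda'''}(\Pi)$, and its adjoint $(RC_{\lambda',\lambda''}^{\lambda'''})^*:H^2_{\lambda'''}(\Pi)\to H^2_{\lambda',\lambda''}(\Pi\times\Pi)$ is given, for all $g\in H^2_{\lambda'''}(\Pi)$ and all $w_1,w_2\in\Pi$, by the absolutely convergent integral $$(RC_{\lambda',\lambda''}^{\lambda'''})^*g(w_1,w_2)=(-1)^l\,C(\lambda',\lambda'')\int_\Pi g(z)\,K_{\lambda',\lambda''}^{\lambda'''}(z,w_1,w_2)\,y^{\lambda'''-2}\,dx\,dy\qquad(z=x+iy),$$ where $$K_{\lambda',\lambda''}^{\lambda'''}(z,w_1,w_2)=(w_2-w_1)^l\left(\frac{w_1-\bar z}{2i}\right)^{-(\lambda'+l)}\left(\frac{w_2-\bar z}{2i}\right)^{-(\lambda''+l)},\qquad C(\lambda',\lambda'')=\frac{(\lambda'-1)_{l+1}(\lambda''-1)_{l+1}}{2^{2l+4}\pi^2\,l!},$$ and the powers are the principal ones (both bases have positive real part). -/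

import Mathlib

open MeasureTheory Set Filter Topology Metric
open scoped ENNReal ComplexConjugate Nat

noncomputable section

namespace Bergman

section General

variable {E : Type*} [NormedAddCommGroup E] [NormedSpace ℂ E] [MeasureSpace E]

/-- The measure `w(z) dz` on the subset `U` of `E` (extended by zero to `E`), where `dz` is the
standard volume. -/
def weightMeasure (U : Set E) (w : E → ℝ) : Measure E :=
  (volume.restrict U).withDensity fun z => ENNReal.ofReal (w z)

/-- The holomorphic functions on `U` that are square integrable against `w(z) dz`, as a complex
vector space.  A function on `U` is represented by its extension by zero to the ambient
space `E`, so that two elements are equal exactly when they agree on `U`. -/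
def holL2 (U : Set E) (w : E → ℝ) : Submodule ℂ (E → ℂ) where
  carrier := {f | DifferentiableOn ℂ f U ∧ (∀ z, z ∉ U → f z = 0) ∧
    MemLp f 2 (weightMeasure U w)}
  add_mem' := by
    rintro f g ⟨hf, hf0, hf2⟩ ⟨hg, hg0, hg2⟩
    exact ⟨hf.add hg, fun z hz => by simp [hf0 z hz, hg0 z hz], hf2.add hg2⟩
  zero_mem' := ⟨differentiableOn_const 0, fun _ _ => rfl, MemLp.zero⟩
  smul_mem' := by
    rintro c f ⟨hf, hf0, hf2⟩
    exact ⟨hf.const_smul c, fun z hz => by simp [hf0 z hz], hf2.const_smul c⟩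

/-- The weighted Bergman space of `U`, as a type of its own: it carries the topology of the
`L²` norm, not that of pointwise convergence. -/
def Space (U : Set E) (w : E → ℝ) : Type _ := holL2 U w

instance (U : Set E) (w : E → ℝ) : AddCommGroup (Space U w) :=
  inferInstanceAs (AddCommGroup (holL2 U w))

instance (U : Set E) (w : E → ℝ) : Module ℂ (Space U w) :=
  inferInstanceAs (Module ℂ (holL2 U w))

instance (U : Set E) (w : E → ℝ) : CoeFun (Space U w) fun _ => E → ℂ := ⟨fun f => f.1⟩

/-- The inclusion of the Bergman space in the Hilbert space `L²(U, w(z) dz)`. -/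
def toL2 (U : Set E) (w : E → ℝ) : Space U w →ₗ[ℂ] Lp ℂ 2 (weightMeasure U w) where
  toFun f := f.2.2.2.toLp f.1
  map_add' _ _ := rfl
  map_smul' _ _ := rfl

theorem coeFn_toL2 {U : Set E} {w : E → ℝ} (f : Space U w) :
    (toL2 U w f : E → ℂ) =ᵐ[weightMeasure U w] f.1 := f.2.2.2.coeFn_toLp

/-- `U` is open, the weight is positive and continuous on `U`, and the volume of the
ambient space is invariant under multiplication by complex numbers of modulus one. -/
class IsWeight (U : Set E) (w : E → ℝ) : Prop where
  isOpen : IsOpen U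
  continuousOn : ContinuousOn w U
  pos : ∀ z ∈ U, 0 < w z
  rot : ∀ a : ℂ, ‖a‖ = 1 → MeasurePreserving (fun v : E => a • v)

variable [BorelSpace E] [SFinite (volume : Measure E)]
  [(volume : Measure E).IsAddHaarMeasure]

/-- Sub-mean value property of `|f|²` for `f` holomorphic on a ball. -/
theorem volume_mul_sq_le
    (rot : ∀ a : ℂ, ‖a‖ = 1 → MeasurePreserving (fun v : E => a • v))
    {f : E → ℂ} {c : E} {R : ℝ} (hf : DifferentiableOn ℂ f (ball c R)) :
    volume (ball (0 : E) R) * ‖f c‖ₑ ^ 2 ≤ ∫⁻ x in ball c R, ‖f x‖ₑ ^ 2 := by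
  classical
  set F : E → ℂ := (ball c R).piecewise f 0 with hF
  have hFm : Measurable F :=
    hf.continuousOn.measurable_piecewise continuousOn_const measurableSet_ball
  set T : ℝ≥0∞ := ENNReal.ofReal (2 * Real.pi) with hT
  have hT0 : T ≠ 0 := by rw [hT]; simp [Real.pi_pos]
  have hTt : T ≠ ∞ := ENNReal.ofReal_ne_top
  have key : ∀ v ∈ ball (0 : E) R, T * ‖f c‖ₑ ^ 2 ≤
      ∫⁻ θ in Ioc 0 (2 * Real.pi), ‖F (c + circleMap 0 1 θ • v)‖ₑ ^ 2 := by
    intro v hv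
    have hv' : ‖v‖ < R := by simpa using hv
    have hmem : ∀ t : ℂ, ‖t‖ ≤ 1 → c + t • v ∈ ball c R := by
      intro t ht
      have : ‖t‖ * ‖v‖ ≤ 1 * ‖v‖ := by gcongr
      simp only [mem_ball, dist_self_add_left, norm_smul]
      linarith
    have hd : ∀ t : ℂ, ‖t‖ ≤ 1 → DifferentiableAt ℂ (fun t : ℂ => f (c + t • v) ^ 2) t := by
      intro t ht
      have h1 : DifferentiableAt ℂ f (c + t • v) :=
        hf.differentiableAt (isOpen_ball.mem_nhds (hmem t ht))
      have h2 : DifferentiableAt ℂ (fun t : ℂ => c + t • v) t := by fun_prop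
      exact (DifferentiableAt.comp t h1 h2).pow 2
    have havg : Real.circleAverage (fun t : ℂ => f (c + t • v) ^ 2) 0 1 = f c ^ 2 := by
      have := DiffContOnCl.circleAverage (f := fun t : ℂ => f (c + t • v) ^ 2) (c := 0) (R := 1)
        (DifferentiableOn.diffContOnCl (by
          intro t ht
          rw [closure_ball _ (by simp)] at ht
          exact (hd t (by simpa using ht)).differentiableWithinAt))
      simpa using this
    rw [Real.circleAverage_def, intervalIntegral.integral_of_le (by positivity)] at havg
    have hI : ∫ θ in Ioc 0 (2 * Real.pi), f (c + circleMap 0 1 θ • v) ^ 2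
        = (2 * Real.pi) • f c ^ 2 := by
      rw [← havg, smul_smul, mul_inv_cancel₀ (by positivity), one_smul]
    have hle := enorm_integral_le_lintegral_enorm (μ := volume.restrict (Ioc 0 (2 * Real.pi)))
      (fun θ => f (c + circleMap 0 1 θ • v) ^ 2)
    rw [hI, enorm_smul, enorm_pow, Real.enorm_of_nonneg (by positivity)] at hle
    refine hle.trans (le_of_eq ?_)
    refine lintegral_congr fun θ => ?_
    rw [enorm_pow, hF, piecewise_eq_of_mem _ _ _ (hmem _ (by simp))]
  have hjoint : Measurable fun p : E × ℝ => ‖F (c + circleMap 0 1 p.2 • p.1)‖ₑ ^ 2 := by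
    have : Continuous fun p : E × ℝ => c + circleMap 0 1 p.2 • p.1 := by
      have := continuous_circleMap (0 : ℂ) 1
      fun_prop
    exact (hFm.comp this.measurable).enorm.pow_const 2
  have hsq : Measurable fun v : E => ‖F v‖ₑ ^ 2 := hFm.enorm.pow_const 2
  have hmain : T * (volume (ball (0 : E) R) * ‖f c‖ₑ ^ 2) ≤ T * ∫⁻ x, ‖F x‖ₑ ^ 2 := by
    calc T * (volume (ball (0 : E) R) * ‖f c‖ₑ ^ 2)
        = ∫⁻ _ in ball (0 : E) R, T * ‖f c‖ₑ ^ 2 := by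
          rw [setLIntegral_const]; ring
      _ ≤ ∫⁻ v in ball (0 : E) R,
            ∫⁻ θ in Ioc 0 (2 * Real.pi), ‖F (c + circleMap 0 1 θ • v)‖ₑ ^ 2 :=
          setLIntegral_mono' measurableSet_ball key
      _ ≤ ∫⁻ v : E, ∫⁻ θ in Ioc 0 (2 * Real.pi), ‖F (c + circleMap 0 1 θ • v)‖ₑ ^ 2 :=
          setLIntegral_le_lintegral _ _
      _ = ∫⁻ θ in Ioc 0 (2 * Real.pi), ∫⁻ v : E, ‖F (c + circleMap 0 1 θ • v)‖ₑ ^ 2 :=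
          lintegral_lintegral_swap hjoint.aemeasurable
      _ = ∫⁻ _ in Ioc 0 (2 * Real.pi), ∫⁻ v : E, ‖F v‖ₑ ^ 2 := by
          refine lintegral_congr fun θ => ?_
          have h1 := (rot (circleMap 0 1 θ) (by simp)).lintegral_comp
            (f := fun v => ‖F (c + v)‖ₑ ^ 2) (hsq.comp (measurable_const_add c))
          rw [h1]
          exact lintegral_add_left_eq_self (fun v => ‖F v‖ₑ ^ 2) c
      _ = T * ∫⁻ x, ‖F x‖ₑ ^ 2 := by
          rw [setLIntegral_const, Real.volume_Ioc, sub_zero, mul_comm]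
  have hFint : ∫⁻ x, ‖F x‖ₑ ^ 2 = ∫⁻ x in ball c R, ‖f x‖ₑ ^ 2 := by
    rw [← lintegral_indicator measurableSet_ball]
    refine lintegral_congr fun x => ?_
    by_cases hx : x ∈ ball c R
    · rw [hF, piecewise_eq_of_mem _ _ _ hx, indicator_of_mem hx]
    · rw [hF, piecewise_eq_of_notMem _ _ _ hx, indicator_of_notMem hx]; simp
  rw [← hFint]
  exact (ENNReal.mul_le_mul_iff_right hT0 hTt).1 hmain

variable [ProperSpace E]

/-- Point evaluations are locally uniformly bounded in the `L²` norm. -/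
theorem exists_local_bound {U : Set E} {w : E → ℝ} [IsWeight U w] {z : E} (hz : z ∈ U) :
    ∃ r > 0, ∃ C : ℝ, 0 ≤ C ∧ ball z r ⊆ U ∧
      ∀ f : Space U w, ∀ x ∈ ball z r, ‖f x‖ ≤ C * ‖toL2 U w f‖ := by
  have hU : IsOpen U := IsWeight.isOpen w
  have hwz : 0 < w z := IsWeight.pos z hz
  have hwc : ContinuousOn w U := IsWeight.continuousOn
  have hnhds : {x | w z / 2 < w x} ∩ U ∈ 𝓝 z :=
    inter_mem ((hwc.continuousAt (hU.mem_nhds hz)).eventually_const_lt (by linarith))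
      (hU.mem_nhds hz)
  obtain ⟨ρ, hρ, hρU⟩ := Metric.mem_nhds_iff.1 hnhds
  have hr : 0 < ρ / 2 := by positivity
  set m : ℝ≥0∞ := ENNReal.ofReal (w z / 2) with hm
  have hm0 : m ≠ 0 := by rw [hm]; simp [hwz]
  have hmt : m ≠ ∞ := ENNReal.ofReal_ne_top
  set V : ℝ≥0∞ := volume (ball (0 : E) (ρ / 2)) with hV
  have hV0 : V ≠ 0 := (measure_ball_pos _ _ hr).ne'
  have hw : AEMeasurable (fun x => ENNReal.ofReal (w x)) (volume.restrict U) :=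
    (hwc.aemeasurable hU.measurableSet).ennreal_ofReal
  have main : ∀ f : Space U w, ∀ x ∈ ball z (ρ / 2),
      m * V * ‖f x‖ₑ ^ 2 ≤ ‖toL2 U w f‖ₑ ^ 2 := by
    intro f x hx
    have hsub : ball x (ρ / 2) ⊆ ball z ρ := by
      intro y hy
      have h1 : dist y x < ρ / 2 := hy
      have h2 : dist x z < ρ / 2 := hx
      have := dist_triangle y x z
      simp only [mem_ball]; linarith
    have hfd : DifferentiableOn ℂ f.1 (ball x (ρ / 2)) :=
      f.2.1.mono fun y hy => (hρU (hsub hy)).2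
    have h2 : ‖toL2 U w f‖ₑ ^ 2 = ∫⁻ x in U, ENNReal.ofReal (w x) * ‖f x‖ₑ ^ 2 := by
      have hn : ‖toL2 U w f‖ₑ = eLpNorm f.1 2 (weightMeasure U w) :=
        Lp.enorm_toLp f.2.2.2
      have h3 := eLpNorm_nnreal_pow_eq_lintegral (f := f.1) (μ := weightMeasure U w)
        (p := 2) two_ne_zero
      rw [hn]
      simp only [ENNReal.coe_ofNat, NNReal.coe_ofNat, ENNReal.rpow_ofNat] at h3
      rw [h3, weightMeasure, lintegral_withDensity_eq_lintegral_mul₀' hw]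
      · rfl
      · exact f.2.2.2.1.enorm.pow_const 2
    calc m * V * ‖f x‖ₑ ^ 2 = m * (V * ‖f x‖ₑ ^ 2) := mul_assoc _ _ _
      _ ≤ m * ∫⁻ y in ball x (ρ / 2), ‖f y‖ₑ ^ 2 := by
          gcongr
          exact volume_mul_sq_le (IsWeight.rot U w) hfd
      _ = ∫⁻ y in ball x (ρ / 2), m * ‖f y‖ₑ ^ 2 := (lintegral_const_mul' _ _ hmt).symm
      _ ≤ ∫⁻ y in ball x (ρ / 2), ENNReal.ofReal (w y) * ‖f y‖ₑ ^ 2 := by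
          refine setLIntegral_mono' measurableSet_ball fun y hy => ?_
          gcongr
          exact ENNReal.ofReal_le_ofReal (le_of_lt (hρU (hsub hy)).1)
      _ ≤ ∫⁻ y in U, ENNReal.ofReal (w y) * ‖f y‖ₑ ^ 2 :=
          lintegral_mono_set fun y hy => (hρU (hsub hy)).2
      _ = ‖toL2 U w f‖ₑ ^ 2 := h2.symm
  have hVt : V ≠ ∞ := (measure_ball_lt_top).ne
  set κ : ℝ := (m * V).toReal with hκ
  have hκ0 : 0 < κ := ENNReal.toReal_pos (mul_ne_zero hm0 hV0) (ENNReal.mul_ne_top hmt hVt)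
  refine ⟨ρ / 2, hr, Real.sqrt κ⁻¹, Real.sqrt_nonneg _, fun y hy => ?_, fun f x hx => ?_⟩
  · exact (hρU (ball_subset_ball (by linarith) hy)).2
  · have h1 := ENNReal.toReal_mono (by simp) (main f x hx)
    rw [ENNReal.toReal_mul, ENNReal.toReal_pow, ENNReal.toReal_pow, toReal_enorm, toReal_enorm,
      ← hκ] at h1
    refine le_of_sq_le_sq ?_ (by positivity)
    rw [mul_pow, Real.sq_sqrt (by positivity), inv_mul_eq_div, le_div_iff₀ hκ0]
    linarith

theorem toL2_injective (U : Set E) (w : E → ℝ) [IsWeight U w] :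
    Function.Injective (toL2 U w) := by
  rw [injective_iff_map_eq_zero]
  intro f hf
  refine Subtype.ext (funext fun z => ?_)
  by_cases hz : z ∈ U
  · obtain ⟨r, hr, C, -, -, h⟩ := exists_local_bound (w := w) hz
    have := h f z (mem_ball_self hr)
    rw [hf, norm_zero, mul_zero] at this
    exact norm_le_zero_iff.1 this
  · exact f.2.2.1 z hz

/-- The norm of the Bergman space is the `L²` norm. -/
instance (U : Set E) (w : E → ℝ) [IsWeight U w] : NormedAddCommGroup (Space U w) :=
  NormedAddCommGroup.induced _ _ (toL2 U w) (toL2_injective U w)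

/-- The inner product of the Bergman space is the `L²` inner product. -/
instance (U : Set E) (w : E → ℝ) [IsWeight U w] : InnerProductSpace ℂ (Space U w) :=
  InnerProductSpace.induced (toL2 U w)

theorem inner_eq_integral {U : Set E} {w : E → ℝ} [IsWeight U w] (f g : Space U w) :
    inner ℂ f g = ∫ z, conj (f z) * g z ∂weightMeasure U w := by
  have h : inner ℂ f g = inner ℂ (toL2 U w f) (toL2 U w g) := rfl
  rw [h, L2.inner_def]
  refine integral_congr_ae ?_
  filter_upwards [coeFn_toL2 f, coeFn_toL2 g] with z h1 h2
  rw [h1, h2, RCLike.inner_apply, mul_comm]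

theorem norm_eq_norm_toL2 {U : Set E} {w : E → ℝ} [IsWeight U w] (f : Space U w) :
    ‖f‖ = ‖toL2 U w f‖ := rfl

theorem isometry_toL2 (U : Set E) (w : E → ℝ) [IsWeight U w] : Isometry (toL2 U w) :=
  AddMonoidHomClass.isometry_of_norm _ fun _ => rfl

/-- The weighted Bergman space is a Hilbert space. -/
instance (U : Set E) (w : E → ℝ) [IsWeight U w] : CompleteSpace (Space U w) := by
  have hU : IsOpen U := IsWeight.isOpen w
  refine Metric.complete_of_cauchySeq_tendsto fun u hu => ?_
  have hsub : ∀ (f g : Space U w) (x : E), (f - g) x = f x - g x := fun _ _ _ => rfl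
  have hev : ∀ x, CauchySeq fun n => u n x := by
    intro x
    by_cases hx : x ∈ U
    · obtain ⟨r, hr, C, hC, -, h⟩ := exists_local_bound (w := w) hx
      have hlip : LipschitzWith ⟨C, hC⟩ fun f : Space U w => f x := by
        refine LipschitzWith.of_dist_le_mul fun f g => ?_
        rw [dist_eq_norm, dist_eq_norm]
        exact h (f - g) x (mem_ball_self hr)
      exact hlip.cauchySeq_comp hu
    · have : (fun n => u n x) = fun _ => 0 := funext fun n => (u n).2.2.1 x hx
      rw [this]
      exact cauchySeq_const 0
  choose F hF using fun x => cauchySeq_tendsto_of_complete (hev x)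
  obtain ⟨G, hG⟩ := cauchySeq_tendsto_of_complete
    ((isometry_toL2 U w).lipschitz.cauchySeq_comp hu)
  have hF0 : ∀ x, x ∉ U → F x = 0 := by
    intro x hx
    have : (fun n => u n x) = fun _ => 0 := funext fun n => (u n).2.2.1 x hx
    have h2 := hF x
    rw [this] at h2
    exact tendsto_nhds_unique h2 tendsto_const_nhds
  have hGF : (G : E → ℂ) =ᵐ[weightMeasure U w] F := by
    obtain ⟨ns, hns, hae⟩ := (tendstoInMeasure_of_tendsto_Lp hG).exists_seq_tendsto_ae
    have hall : ∀ᵐ x ∂weightMeasure U w, ∀ n, (toL2 U w (u n) : E → ℂ) x = u n x :=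
      ae_all_iff.2 fun n => coeFn_toL2 (u n)
    filter_upwards [hae, hall] with x h1 h2
    refine tendsto_nhds_unique h1 ?_
    have h3 := (hF x).comp hns.tendsto_atTop
    refine h3.congr fun n => ?_
    exact (h2 (ns n)).symm
  have hFL : MemLp F 2 (weightMeasure U w) := (memLp_congr_ae hGF).1 (Lp.memLp G)
  have hFd : DifferentiableOn ℂ F U := by
    intro z hz
    obtain ⟨r, hr, C, hC, hrU, h⟩ := exists_local_bound (w := w) hz
    have hr2 : 0 < r / 2 := by positivity
    have hballs : ∀ x ∈ ball z (r / 2), ball x (r / 2) ⊆ ball z r := by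
      intro x hx y hy
      have h1 : dist y x < r / 2 := hy
      have h2 : dist x z < r / 2 := hx
      have := dist_triangle y x z
      simp only [mem_ball]; linarith
    have hdiff : ∀ (f : Space U w), ∀ x ∈ ball z r, DifferentiableAt ℂ f.1 x :=
      fun f x hx => f.2.1.differentiableAt (hU.mem_nhds (hrU hx))
    have hder : ∀ f : Space U w, ∀ x ∈ ball z (r / 2),
        ‖fderiv ℂ f.1 x‖ ≤ 2 * C / (r / 2) * ‖f‖ := by
      intro f x hx
      have h1 := Complex.norm_fderiv_le_div_of_mapsTo_ball (f := f.1) (c := x) (R₁ := r / 2)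
        (R₂ := 2 * C * ‖f‖)
        (fun y hy => (hdiff f y (hballs x hx hy)).differentiableWithinAt)
        (fun y hy => by
          have h2 := h f y (hballs x hx hy)
          have h3 := h f x (hballs x hx (mem_ball_self hr2))
          rw [← norm_eq_norm_toL2] at h2 h3
          rw [mem_closedBall, dist_eq_norm]
          refine (norm_sub_le _ _).trans ?_
          linarith) hr2
      refine h1.trans (le_of_eq ?_)
      ring
    set D : ℝ := 2 * C / (r / 2) with hD
    have hD0 : 0 ≤ D := by positivity
    have hdd : ∀ m n : ℕ, ∀ x ∈ ball z (r / 2),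
        dist (fderiv ℂ (u m).1 x) (fderiv ℂ (u n).1 x) ≤ D * dist (u m) (u n) := by
      intro m n x hx
      have hx' : x ∈ ball z r := ball_subset_ball (by linarith) hx
      rw [dist_eq_norm, dist_eq_norm, ← fderiv_sub (hdiff _ x hx') (hdiff _ x hx')]
      exact hder (u m - u n) x hx
    have hUC : UniformCauchySeqOn (fun n x => fderiv ℂ (u n).1 x) atTop (ball z (r / 2)) := by
      rw [Metric.uniformCauchySeqOn_iff]
      intro ε hε
      obtain ⟨N, hN⟩ := Metric.cauchySeq_iff.1 hu (ε / (D + 1)) (by positivity)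
      refine ⟨N, fun m hm n hn x hx => (hdd m n x hx).trans_lt ?_⟩
      have h1 := hN m hm n hn
      rw [lt_div_iff₀ (by positivity)] at h1
      nlinarith [dist_nonneg (x := u m) (y := u n)]
    have hlim : ∀ x, ∃ L, x ∈ ball z (r / 2) →
        Tendsto (fun n => fderiv ℂ (u n).1 x) atTop (𝓝 L) := by
      intro x
      by_cases hx : x ∈ ball z (r / 2)
      · obtain ⟨L, hL⟩ := cauchySeq_tendsto_of_complete (hUC.cauchySeq hx)
        exact ⟨L, fun _ => hL⟩
      · exact ⟨0, fun h => absurd h hx⟩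
    choose F' hF' using hlim
    have := hasFDerivAt_of_tendstoUniformlyOn isOpen_ball
      (hUC.tendstoUniformlyOn_of_tendsto hF')
      (fun n x hx => (hdiff (u n) x (ball_subset_ball (by linarith) hx)).hasFDerivAt)
      (fun x _ => hF x) (mem_ball_self hr2)
    exact this.differentiableAt.differentiableWithinAt
  have hmem : F ∈ holL2 U w := ⟨hFd, hF0, hFL⟩
  let F₀ : Space U w := ⟨F, hmem⟩
  have hG' : toL2 U w F₀ = G := Lp.ext ((coeFn_toL2 F₀).trans hGF.symm)
  refine ⟨F₀, (isometry_toL2 U w).isEmbedding.tendsto_nhds_iff.2 ?_⟩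
  rw [hG']
  exact hG

end General

/-- The upper half-plane `Π`, as a subset of `ℂ`. -/
abbrev halfPlane : Set ℂ := UpperHalfPlane.upperHalfPlaneSet

/-- The weight `y ^ (lam - 2)` at `z = x + i y`. -/
def weight (lam : ℝ) (z : ℂ) : ℝ := z.im ^ (lam - 2)

/-- The weight `y₁ ^ (lam - 2) * y₂ ^ (mu - 2)` at `(x₁ + i y₁, x₂ + i y₂)`. -/
def weight₂ (lam mu : ℝ) (z : ℂ × ℂ) : ℝ := weight lam z.1 * weight mu z.2

theorem continuousOn_weight (lam : ℝ) : ContinuousOn (weight lam) halfPlane :=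
  Complex.continuous_im.continuousOn.rpow_const fun _ hz => Or.inl (ne_of_gt hz)

theorem measurePreserving_smul (a : ℂ) (ha : ‖a‖ = 1) :
    MeasurePreserving (fun v : ℂ => a • v) :=
  (rotation ⟨a, by simpa [Submonoid.unitSphere] using ha⟩).measurePreserving

instance : (volume : Measure (ℂ × ℂ)).IsAddHaarMeasure :=
  Measure.prod.instIsAddHaarMeasure volume volume

instance (lam : ℝ) : IsWeight halfPlane (weight lam) where
  isOpen := UpperHalfPlane.isOpen_upperHalfPlaneSet
  continuousOn := continuousOn_weight lam
  pos _ hz := Real.rpow_pos_of_pos hz _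
  rot := measurePreserving_smul

instance (lam mu : ℝ) : IsWeight (halfPlane ×ˢ halfPlane) (weight₂ lam mu) where
  isOpen := UpperHalfPlane.isOpen_upperHalfPlaneSet.prod UpperHalfPlane.isOpen_upperHalfPlaneSet
  continuousOn := ((continuousOn_weight lam).comp continuousOn_fst fun _ h => h.1).mul
    ((continuousOn_weight mu).comp continuousOn_snd fun _ h => h.2)
  pos _ hz := mul_pos (Real.rpow_pos_of_pos hz.1 _) (Real.rpow_pos_of_pos hz.2 _)
  rot a ha := (measurePreserving_smul a ha).prod (measurePreserving_smul a ha)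

/-- The weighted Bergman space `H²_lam(Π) = 𝒪(Π) ∩ L²(Π, y ^ (lam - 2) dx dy)`. -/
abbrev H2 (lam : ℝ) : Type := Space halfPlane (weight lam)

/-- The weighted Bergman space of the product,
`𝒪(Π × Π) ∩ L²(Π × Π, y₁ ^ (lam - 2) y₂ ^ (mu - 2) dx₁ dy₁ dx₂ dy₂)`, which realizes the
Hilbert space tensor product of `H²_lam(Π)` and `H²_mu(Π)`. -/
abbrev H2Prod (lam mu : ℝ) : Type := Space (halfPlane ×ˢ halfPlane) (weight₂ lam mu)

/-- The Pochhammer symbol `(a)_n = a (a + 1) ⋯ (a + n - 1)`. -/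
def poch (a : ℝ) (n : ℕ) : ℝ := (ascPochhammer ℝ n).eval a

/-- The mixed derivative `∂^(m + n) f / ∂z₁^m ∂z₂^n` at the point `w`. -/
def mixedDeriv (m n : ℕ) (f : ℂ × ℂ → ℂ) (w : ℂ × ℂ) : ℂ :=
  iteratedDeriv m (fun z₁ => iteratedDeriv n (fun z₂ => f (z₁, z₂)) w.2) w.1

/-- The bidifferential operator whose restriction to the diagonal is the Rankin-Cohen
operator. -/
def rankinCohenDiff (lam mu : ℝ) (l : ℕ) (f : ℂ × ℂ → ℂ) (w : ℂ × ℂ) : ℂ :=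
  ∑ j ∈ Finset.range (l + 1),
    (((-1) ^ j * poch (lam + l - j) j * poch (mu + j) (l - j) / (j ! * (l - j)!) : ℝ) : ℂ) *
      mixedDeriv (l - j) j f w

/-- The Rankin-Cohen operator. -/
def rankinCohen (lam mu : ℝ) (l : ℕ) (f : ℂ × ℂ → ℂ) (z : ℂ) : ℂ :=
  rankinCohenDiff lam mu l f (z, z)

/-- The relative reproducing kernel.  Both bases `(w - conj z) / 2i` have positive real part for
`w, z` in the upper half-plane, and the powers are the principal ones. -/
def relKernel (lam mu : ℝ) (l : ℕ) (z w₁ w₂ : ℂ) : ℂ :=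
  (w₂ - w₁) ^ l * ((w₁ - conj z) / (2 * Complex.I)) ^ (-((lam + l : ℝ) : ℂ)) *
    ((w₂ - conj z) / (2 * Complex.I)) ^ (-((mu + l : ℝ) : ℂ))

/-- The constant in front of the integral operator. -/
def relConst (lam mu : ℝ) (l : ℕ) : ℝ :=
  poch (lam - 1) (l + 1) * poch (mu - 1) (l + 1) / (2 ^ (2 * l + 4) * Real.pi ^ 2 * l !)

end Bergman

end

/-! Boundedness is local. The weights are comparable to constants on the bidisc of radius y/2 about
(z, z), so the sub-mean value property and Cauchy's estimates give y^(λ'''-2) |∂^l f(z, z)|² ≤ K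
y^(-2) m(z), where m(z) is the weighted mass of |f|² on that bidisc
(`exists_local_mixedDeriv_bound`). Now integrate over z and exchange the integrals: a point x is
counted with weight at most the hyperbolic area of the z whose disc contains x₁, and this area is
bounded independently of x (`lintegral_inv_sq_le`, `lintegral_localMass_le`). Each term of the
Rankin–Cohen sum is therefore bounded (`exists_diagDeriv_clm`).

The adjoint is found by testing against reproducing kernels. Up to the factor
(4π/(λ'-1))(4π/(λ''-1)), the value of RC* g at w is ⟨k_w, RC* g⟩ = ⟨RC k_w, g⟩, so it is enough to
compute RC k_w. Differentiating a power raises its exponent by one, and the Pochhammer coefficients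
turn the sum into a binomial expansion of (B - A)^l, with A and B the bases of the two powers. The
difference B - A does not depend on z, and RC k_w collapses to a multiple of the conjugate of the
relative kernel (`rankinCohen_prodKernel`, `conj_rankinCohen_prodKernel`).

The reproducing formula (`integral_mul_powKernel`) comes from the Cayley transform sending 0 to w:
the integrand becomes a holomorphic function times a radial weight on the disc, and the mean value
property applies. Fubini extends it to the product. -/

noncomputable section

namespace Bergman

/-! ### Holomorphic functions of two variables and Cauchy estimates. -/

section SeveralVariables

/-- The directional derivatives of a holomorphic function are holomorphic. -/
theorem differentiableOn_fderiv_apply {E : Type*} [NormedAddCommGroup E] [NormedSpace ℂ E]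
    [FiniteDimensional ℂ E] [MeasurableSpace E] [BorelSpace E] {U : Set E} (hU : IsOpen U)
    {f : E → ℂ} (hf : DifferentiableOn ℂ f U) (v : E) :
    DifferentiableOn ℂ (fun x => fderiv ℂ f x v) U := by
  intro x₀ hx₀
  have hfc : ContinuousAt f x₀ := (hf.differentiableAt (hU.mem_nhds hx₀)).continuousAt
  set M : ℝ := ‖f x₀‖ + 1 with hM
  have hnhds : {x | ‖f x‖ < M} ∩ U ∈ 𝓝 x₀ :=
    inter_mem (hfc.norm.eventually_lt_const (by linarith)) (hU.mem_nhds hx₀)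
  obtain ⟨ρ, hρ, hρU⟩ := Metric.mem_nhds_iff.1 hnhds
  -- One third each for the base point x, for the circle about x in direction v, and for the ball on
  -- which the derivative is estimated.
  set δ : ℝ := ρ / 3 with hδ
  have hδ0 : 0 < δ := by positivity
  -- The `+ 1` covers `v = 0`.
  set r : ℝ := δ / (‖v‖ + 1) with hr
  have hr0 : 0 < r := by positivity
  have hrv : r * ‖v‖ < δ := by
    rw [hr, div_mul_eq_mul_div, div_lt_iff₀ (by positivity)]
    nlinarith [norm_nonneg v]
  have hdisc : ∀ x ∈ ball x₀ δ, ∀ t : ℂ, ‖t‖ ≤ r → x + t • v ∈ ball x₀ (2 * δ) := by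
    intro x hx t ht
    have h1 : ‖t • v‖ ≤ r * ‖v‖ := by rw [norm_smul]; gcongr
    rw [mem_ball_iff_norm] at hx ⊢
    calc ‖x + t • v - x₀‖ = ‖(x - x₀) + t • v‖ := by congr 1; abel
      _ ≤ ‖x - x₀‖ + ‖t • v‖ := norm_add_le _ _
      _ < 2 * δ := by linarith
  have hsub : ∀ x ∈ ball x₀ (2 * δ), ball x δ ⊆ ball x₀ ρ := by
    intro x hx y hy
    have h1 : dist y x < δ := hy
    have h2 : dist x x₀ < 2 * δ := hx
    have := dist_triangle y x x₀
    simp only [mem_ball]; linarith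
  have hdiff : ∀ x ∈ ball x₀ ρ, DifferentiableAt ℂ f x := fun x hx =>
    hf.differentiableAt (hU.mem_nhds (hρU hx).2)
  have hbd : ∀ x ∈ ball x₀ (2 * δ), ‖fderiv ℂ f x‖ ≤ 2 * M / δ := by
    intro x hx
    refine Complex.norm_fderiv_le_div_of_mapsTo_ball
      (fun y hy => (hdiff y (hsub x hx hy)).differentiableWithinAt) (fun y hy => ?_) hδ0
    have h1 : ‖f y‖ < M := (hρU (hsub x hx hy)).1
    have h2 : ‖f x‖ < M := (hρU (hsub x hx (mem_ball_self hδ0))).1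
    rw [mem_closedBall_iff_norm]
    exact (norm_sub_le _ _).trans (by linarith)
  have h2δ : ball x₀ (2 * δ) ⊆ ball x₀ ρ := ball_subset_ball (by linarith)
  -- The kernel of Cauchy's formula for a first derivative. On the complex line x + t v the formula
  -- writes the directional derivative as an integral of values of f, which is then differentiated
  -- in x under the integral sign.
  set q : ℝ → ℂ := fun θ => deriv (circleMap 0 r) θ * ((circleMap 0 r θ - 0) ^ 2)⁻¹ with hq
  have hqc : Continuous q := by
    have h1 : Continuous (circleMap 0 r) := continuous_circleMap 0 r
    refine Continuous.mul ?_ (Continuous.inv₀ (by fun_prop) fun θ => ?_)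
    · rw [show deriv (circleMap 0 r) = fun θ => circleMap 0 r θ * Complex.I from
        funext fun θ => deriv_circleMap 0 r θ]
      fun_prop
    · simpa using hr0.ne'
  have hcm : ∀ θ, ‖circleMap 0 r θ‖ ≤ r := fun θ => by simp [abs_of_pos hr0]
  have hpath : ∀ x, Continuous fun θ : ℝ => x + circleMap 0 r θ • v := fun x => by
    have h1 : Continuous (circleMap 0 r) := continuous_circleMap 0 r
    fun_prop
  have hFc : ∀ x ∈ ball x₀ δ, Continuous fun θ => q θ * f (x + circleMap 0 r θ • v) := by
    intro x hx
    refine hqc.mul (continuous_iff_continuousAt.2 fun θ => ?_)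
    exact ContinuousAt.comp (f := fun θ : ℝ => x + circleMap 0 r θ • v)
      (hdiff _ (h2δ (hdisc x hx _ (hcm θ)))).continuousAt (hpath x).continuousAt
  have hformula : ∀ x ∈ ball x₀ δ, fderiv ℂ f x v =
      (2 * Real.pi * Complex.I)⁻¹ * ∫ θ in (0)..(2 * Real.pi),
        q θ * f (x + circleMap 0 r θ • v) := by
    intro x hx
    set L : ℂ → E := fun t => x + t • v with hL
    have hLd : Differentiable ℂ L := by rw [hL]; fun_prop
    have hV : IsOpen (L ⁻¹' ball x₀ (2 * δ)) := isOpen_ball.preimage hLd.continuous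
    have h1 := Complex.cderiv_eq_deriv (f := fun t => f (L t)) (z := 0) (r := r) hV
      (fun t ht => (DifferentiableAt.comp t (hdiff _ (h2δ ht)) hLd.differentiableAt
        ).differentiableWithinAt) hr0
      (fun t ht => hdisc x hx t (by simpa using ht))
    have h2 : deriv (fun t => f (L t)) 0 = fderiv ℂ f x v := by
      have hLx : L 0 = x := by simp [hL]
      have h3 : HasDerivAt L v 0 := by
        have := ((hasDerivAt_id (0 : ℂ)).smul_const v).const_add x
        simpa [hL] using this
      have h4 : HasFDerivAt f (fderiv ℂ f x) (L 0) := by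
        rw [hLx]; exact (hdiff x (h2δ (ball_subset_ball (by linarith) hx))).hasFDerivAt
      exact (h4.comp_hasDerivAt (0 : ℂ) h3).deriv
    rw [← h2, ← h1, Complex.cderiv, smul_eq_mul, circleIntegral]
    congr 1
    refine intervalIntegral.integral_congr fun θ _ => ?_
    simp only [hq, hL, smul_eq_mul, mul_assoc]
  have hx₀δ : x₀ ∈ ball x₀ δ := mem_ball_self hδ0
  have hder := intervalIntegral.hasFDerivAt_integral_of_dominated_of_fderiv_le
    (𝕜 := ℂ) (μ := volume) (a := 0) (b := 2 * Real.pi) (s := ball x₀ δ) (x₀ := x₀)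
    (F := fun x θ => q θ * f (x + circleMap 0 r θ • v))
    (F' := fun x θ => q θ • fderiv ℂ f (x + circleMap 0 r θ • v))
    (bound := fun θ => ‖q θ‖ * (2 * M / δ))
    (isOpen_ball.mem_nhds hx₀δ)
    (by
      filter_upwards [isOpen_ball.mem_nhds hx₀δ] with x hx
      exact (hFc x hx).aestronglyMeasurable)
    ((hFc x₀ hx₀δ).intervalIntegrable _ _)
    (by
      -- Only measurability of the derivative is used here; its continuity is not presupposed.
      have h1 : Measurable fun θ => q θ • fderiv ℂ f (x₀ + circleMap 0 r θ • v) :=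
        hqc.measurable.smul ((measurable_fderiv ℂ f).comp (hpath x₀).measurable)
      exact h1.aestronglyMeasurable)
    (ae_of_all _ fun θ _ x hx => by
      rw [norm_smul]
      gcongr
      exact hbd _ (hdisc x hx _ (hcm θ)))
    ((hqc.norm.mul continuous_const).intervalIntegrable _ _)
    (ae_of_all _ fun θ _ x hx => by
      have h1 : HasFDerivAt f (fderiv ℂ f (x + circleMap 0 r θ • v))
          (x + circleMap 0 r θ • v) := (hdiff _ (h2δ (hdisc x hx _ (hcm θ)))).hasFDerivAt
      have h2 := h1.comp x ((hasFDerivAt_id x).add_const (circleMap 0 r θ • v))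
      simpa using h2.const_mul (q θ))
  have hfin := (hder.const_mul (2 * Real.pi * Complex.I)⁻¹).differentiableAt
  refine (hfin.congr_of_eventuallyEq ?_).differentiableWithinAt
  filter_upwards [isOpen_ball.mem_nhds hx₀δ] with x hx using hformula x hx

/-- The partial derivative in the direction `v`, as an operator on functions. -/
def dirDeriv (v : ℂ × ℂ) (f : ℂ × ℂ → ℂ) (w : ℂ × ℂ) : ℂ := fderiv ℂ f w v

theorem differentiableOn_iterate_dirDeriv {U : Set (ℂ × ℂ)} (hU : IsOpen U) {f : ℂ × ℂ → ℂ}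
    (hf : DifferentiableOn ℂ f U) (v : ℂ × ℂ) (n : ℕ) :
    DifferentiableOn ℂ ((dirDeriv v)^[n] f) U := by
  induction n with
  | zero => exact hf
  | succ n ih =>
    rw [Function.iterate_succ_apply']
    exact differentiableOn_fderiv_apply hU ih v

theorem iteratedDeriv_snd_eq {U V : Set ℂ} (hU : IsOpen U) (hV : IsOpen V) {f : ℂ × ℂ → ℂ}
    (hf : DifferentiableOn ℂ f (U ×ˢ V)) (n : ℕ) {z₁ z₂ : ℂ} (h₁ : z₁ ∈ U) (h₂ : z₂ ∈ V) :
    iteratedDeriv n (fun z => f (z₁, z)) z₂ = (dirDeriv (0, 1))^[n] f (z₁, z₂) := by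
  induction n generalizing z₂ with
  | zero => simp
  | succ n ih =>
    rw [iteratedDeriv_succ, Function.iterate_succ_apply']
    have h : iteratedDeriv n (fun z => f (z₁, z)) =ᶠ[𝓝 z₂]
        fun z => (dirDeriv (0, 1))^[n] f (z₁, z) := by
      filter_upwards [hV.mem_nhds h₂] with z hz using ih hz
    rw [h.deriv_eq]
    have hd := (differentiableOn_iterate_dirDeriv (hU.prod hV) hf (0, 1) n).differentiableAt
      ((hU.prod hV).mem_nhds (mk_mem_prod h₁ h₂))
    have hl : HasDerivAt (fun z : ℂ => (z₁, z)) (0, 1) z₂ :=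
      (hasDerivAt_const z₂ z₁).prodMk (hasDerivAt_id z₂)
    exact (hd.hasFDerivAt.comp_hasDerivAt z₂ hl).deriv

theorem iteratedDeriv_fst_eq {U V : Set ℂ} (hU : IsOpen U) (hV : IsOpen V) {f : ℂ × ℂ → ℂ}
    (hf : DifferentiableOn ℂ f (U ×ˢ V)) (n : ℕ) {z₁ z₂ : ℂ} (h₁ : z₁ ∈ U) (h₂ : z₂ ∈ V) :
    iteratedDeriv n (fun z => f (z, z₂)) z₁ = (dirDeriv (1, 0))^[n] f (z₁, z₂) := by
  induction n generalizing z₁ with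
  | zero => simp
  | succ n ih =>
    rw [iteratedDeriv_succ, Function.iterate_succ_apply']
    have h : iteratedDeriv n (fun z => f (z, z₂)) =ᶠ[𝓝 z₁]
        fun z => (dirDeriv (1, 0))^[n] f (z, z₂) := by
      filter_upwards [hU.mem_nhds h₁] with z hz using ih hz
    rw [h.deriv_eq]
    have hd := (differentiableOn_iterate_dirDeriv (hU.prod hV) hf (1, 0) n).differentiableAt
      ((hU.prod hV).mem_nhds (mk_mem_prod h₁ h₂))
    have hl : HasDerivAt (fun z : ℂ => (z, z₂)) (1, 0) z₁ :=
      (hasDerivAt_id z₁).prodMk (hasDerivAt_const z₁ z₂)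
    exact (hd.hasFDerivAt.comp_hasDerivAt z₁ hl).deriv

/-- Iterated one-variable derivatives freeze the other variable. The directional operators keep
both, so joint holomorphy passes from one derivative to the next. -/
theorem mixedDeriv_eq_dirDeriv {U V : Set ℂ} (hU : IsOpen U) (hV : IsOpen V) {f : ℂ × ℂ → ℂ}
    (hf : DifferentiableOn ℂ f (U ×ˢ V)) (m n : ℕ) {w : ℂ × ℂ} (hw : w ∈ U ×ˢ V) :
    mixedDeriv m n f w = (dirDeriv (1, 0))^[m] ((dirDeriv (0, 1))^[n] f) w := by
  have h : (fun z₁ => iteratedDeriv n (fun z₂ => f (z₁, z₂)) w.2) =ᶠ[𝓝 w.1]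
      fun z₁ => (dirDeriv (0, 1))^[n] f (z₁, w.2) := by
    filter_upwards [hU.mem_nhds hw.1] with z hz using iteratedDeriv_snd_eq hU hV hf n hz hw.2
  rw [mixedDeriv, h.iteratedDeriv_eq]
  exact iteratedDeriv_fst_eq hU hV
    (differentiableOn_iterate_dirDeriv (hU.prod hV) hf (0, 1) n) m hw.1 hw.2

theorem differentiableOn_mixedDeriv {U V : Set ℂ} (hU : IsOpen U) (hV : IsOpen V)
    {f : ℂ × ℂ → ℂ} (hf : DifferentiableOn ℂ f (U ×ˢ V)) (m n : ℕ) :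
    DifferentiableOn ℂ (mixedDeriv m n f) (U ×ˢ V) :=
  (differentiableOn_iterate_dirDeriv (hU.prod hV)
    (differentiableOn_iterate_dirDeriv (hU.prod hV) hf (0, 1) n) (1, 0) m).congr
      fun _ hw => mixedDeriv_eq_dirDeriv hU hV hf m n hw

theorem iterate_dirDeriv_add {U : Set (ℂ × ℂ)} (hU : IsOpen U) {f g : ℂ × ℂ → ℂ}
    (hf : DifferentiableOn ℂ f U) (hg : DifferentiableOn ℂ g U) (v : ℂ × ℂ) (n : ℕ) :
    EqOn ((dirDeriv v)^[n] (f + g)) ((dirDeriv v)^[n] f + (dirDeriv v)^[n] g) U := by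
  induction n with
  | zero => exact fun _ _ => rfl
  | succ n ih =>
    intro x hx
    simp only [Function.iterate_succ_apply', Pi.add_apply]
    have h1 := (differentiableOn_iterate_dirDeriv hU hf v n).differentiableAt (hU.mem_nhds hx)
    have h2 := (differentiableOn_iterate_dirDeriv hU hg v n).differentiableAt (hU.mem_nhds hx)
    rw [dirDeriv, (ih.eventuallyEq_of_mem (hU.mem_nhds hx)).fderiv_eq, fderiv_add h1 h2]
    rfl

theorem iterate_dirDeriv_congr {U : Set (ℂ × ℂ)} (hU : IsOpen U) {f g : ℂ × ℂ → ℂ}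
    (h : EqOn f g U) (v : ℂ × ℂ) (n : ℕ) :
    EqOn ((dirDeriv v)^[n] f) ((dirDeriv v)^[n] g) U := by
  induction n with
  | zero => exact h
  | succ n ih =>
    intro x hx
    simp only [Function.iterate_succ_apply']
    rw [dirDeriv, (ih.eventuallyEq_of_mem (hU.mem_nhds hx)).fderiv_eq]
    rfl

theorem mixedDeriv_add {U V : Set ℂ} (hU : IsOpen U) (hV : IsOpen V) {f g : ℂ × ℂ → ℂ}
    (hf : DifferentiableOn ℂ f (U ×ˢ V)) (hg : DifferentiableOn ℂ g (U ×ˢ V)) (m n : ℕ)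
    {w : ℂ × ℂ} (hw : w ∈ U ×ˢ V) :
    mixedDeriv m n (f + g) w = mixedDeriv m n f w + mixedDeriv m n g w := by
  have hUV := hU.prod hV
  rw [mixedDeriv_eq_dirDeriv hU hV (hf.add hg) m n hw, mixedDeriv_eq_dirDeriv hU hV hf m n hw,
    mixedDeriv_eq_dirDeriv hU hV hg m n hw,
    iterate_dirDeriv_congr hUV (iterate_dirDeriv_add hUV hf hg (0, 1) n) (1, 0) m hw]
  exact iterate_dirDeriv_add hUV (differentiableOn_iterate_dirDeriv hUV hf (0, 1) n)
    (differentiableOn_iterate_dirDeriv hUV hg (0, 1) n) (1, 0) m hw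

theorem mixedDeriv_smul (m n : ℕ) (c : ℂ) (f : ℂ × ℂ → ℂ) (w : ℂ × ℂ) :
    mixedDeriv m n (c • f) w = c * mixedDeriv m n f w := by
  simp only [mixedDeriv, Pi.smul_apply, smul_eq_mul, iteratedDeriv_const_mul_field]

/-- Cauchy's estimate for mixed derivatives. -/
theorem norm_mixedDeriv_le {f : ℂ × ℂ → ℂ} {w : ℂ × ℂ} {r R : ℝ} (hr : 0 < r) (hrR : r < R)
    (hf : DifferentiableOn ℂ f (ball w R)) {C : ℝ} (hC : ∀ x ∈ closedBall w r, ‖f x‖ ≤ C)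
    (m n : ℕ) : ‖mixedDeriv m n f w‖ ≤ m ! * (n ! * C / r ^ n) / r ^ m := by
  have hprod : ball w R = ball w.1 R ×ˢ ball w.2 R := (ball_prod_same w.1 w.2 R).symm
  have hcprod : closedBall w r = closedBall w.1 r ×ˢ closedBall w.2 r :=
    (closedBall_prod_same w.1 w.2 r).symm
  rw [hprod] at hf
  have hR : 0 < R := hr.trans hrR
  have hcl : ∀ z : ℂ, closure (ball z r) ⊆ ball z R := fun z =>
    closure_ball_subset_closedBall.trans (closedBall_subset_ball hrR)
  -- The one-variable estimate, used first in z₁ and then in z₂ for each z₁ on the circle.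
  refine Complex.norm_iteratedDeriv_le_of_forall_mem_sphere_norm_le m hr ?_ fun z₁ hz₁ => ?_
  · refine DifferentiableOn.diffContOnCl fun z₁ hz₁ => ?_
    have h1 : (z₁, w.2) ∈ ball w.1 R ×ˢ ball w.2 R := ⟨hcl _ hz₁, mem_ball_self hR⟩
    have hO : IsOpen (ball w.1 R ×ˢ ball w.2 R) := isOpen_ball.prod isOpen_ball
    have h2 := (differentiableOn_iterate_dirDeriv hO hf (0, 1) n).differentiableAt
      (hO.mem_nhds h1)
    have h3 : DifferentiableAt ℂ (fun z : ℂ => (z, w.2)) z₁ := by fun_prop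
    have h4 := DifferentiableAt.comp z₁ h2 h3
    refine (h4.congr_of_eventuallyEq ?_).differentiableWithinAt
    filter_upwards [isOpen_ball.mem_nhds (hcl _ hz₁)] with z hz
    exact iteratedDeriv_snd_eq isOpen_ball isOpen_ball hf n hz (mem_ball_self hR)
  · refine Complex.norm_iteratedDeriv_le_of_forall_mem_sphere_norm_le n hr ?_ fun z₂ hz₂ => ?_
    · refine DifferentiableOn.diffContOnCl fun z₂ hz₂ => ?_
      have h1 : (z₁, z₂) ∈ ball w.1 R ×ˢ ball w.2 R :=
        ⟨closedBall_subset_ball hrR (sphere_subset_closedBall hz₁), hcl _ hz₂⟩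
      have hO : IsOpen (ball w.1 R ×ˢ ball w.2 R) := isOpen_ball.prod isOpen_ball
      have h3 : DifferentiableAt ℂ (fun z : ℂ => (z₁, z)) z₂ := by fun_prop
      exact (DifferentiableAt.comp z₂ (hf.differentiableAt (hO.mem_nhds h1)) h3
        ).differentiableWithinAt
    · refine hC _ ?_
      rw [hcprod]
      exact ⟨sphere_subset_closedBall hz₁, sphere_subset_closedBall hz₂⟩

end SeveralVariables

/-! ### Boundedness of the Rankin–Cohen operator. -/

section Boundedness

theorem eLpNorm_two_sq {α : Type*} [MeasurableSpace α] {μ : Measure α} (f : α → ℂ) :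
    eLpNorm f 2 μ ^ 2 = ∫⁻ x, ‖f x‖ₑ ^ 2 ∂μ := by
  have h := eLpNorm_nnreal_pow_eq_lintegral (f := f) (μ := μ) (p := 2) two_ne_zero
  simpa using h

section Generic

variable {E : Type*} [NormedAddCommGroup E] [NormedSpace ℂ E] [MeasureSpace E]

theorem lintegral_weightMeasure [BorelSpace E] (U : Set E) (w : E → ℝ) [IsWeight U w]
    (h : E → ℝ≥0∞) :
    ∫⁻ x, h x ∂weightMeasure U w = ∫⁻ x in U, ENNReal.ofReal (w x) * h x := by
  have hU : IsOpen U := IsWeight.isOpen w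
  have hw : AEMeasurable (fun x => ENNReal.ofReal (w x)) (volume.restrict U) :=
    ((IsWeight.continuousOn : ContinuousOn w U).aemeasurable hU.measurableSet).ennreal_ofReal
  rw [weightMeasure, lintegral_withDensity_eq_lintegral_mul_non_measurable₀ _ hw
    (ae_of_all _ fun _ => ENNReal.ofReal_lt_top)]
  rfl

theorem measurable_coe [BorelSpace E] {U : Set E} {w : E → ℝ} [IsWeight U w] (f : Space U w) :
    Measurable f.1 := by
  classical
  have hU : IsOpen U := IsWeight.isOpen w
  have h : f.1 = U.piecewise f.1 0 := by
    ext x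
    by_cases hx : x ∈ U
    · rw [piecewise_eq_of_mem _ _ _ hx]
    · rw [piecewise_eq_of_notMem _ _ _ hx, f.2.2.1 x hx]; rfl
  rw [h]
  exact f.2.1.continuousOn.measurable_piecewise continuousOn_const hU.measurableSet

theorem enorm_sq_eq_lintegral [BorelSpace E] [SFinite (volume : Measure E)]
    [(volume : Measure E).IsAddHaarMeasure] [ProperSpace E] {U : Set E} {w : E → ℝ}
    [IsWeight U w] (f : Space U w) :
    ‖f‖ₑ ^ 2 = ∫⁻ x in U, ENNReal.ofReal (w x) * ‖f x‖ₑ ^ 2 := by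
  have h : ‖f‖ₑ = eLpNorm f.1 2 (weightMeasure U w) := by
    rw [← Lp.enorm_toLp f.2.2.2]; rfl
  rw [h, eLpNorm_two_sq, lintegral_weightMeasure]

end Generic

/-- Since |log t| ≤ log 2, one bound serves both signs of the exponent. -/
theorem rpow_neg_abs_le_rpow {t s : ℝ} (h₁ : 1 / 2 ≤ t) (h₂ : t ≤ 2) :
    (2 : ℝ) ^ (-|s|) ≤ t ^ s := by
  have ht : 0 < t := by linarith
  rw [Real.rpow_def_of_pos two_pos, Real.rpow_def_of_pos ht, Real.exp_le_exp]
  have hl2 : 0 < Real.log 2 := Real.log_pos one_lt_two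
  have hl : |Real.log t| ≤ Real.log 2 := by
    rw [abs_le]
    constructor
    · rw [← Real.log_inv]
      exact Real.log_le_log (by norm_num) (by linarith)
    · exact Real.log_le_log ht h₂
  have h3 : |Real.log t * s| ≤ Real.log 2 * |s| := by
    rw [abs_mul]; gcongr
  have := neg_abs_le (Real.log t * s)
  linarith

/-- On this disc heights stay between y/2 and 3y/2. -/
theorem weight_ge {lam : ℝ} {z w : ℂ} (hz : z ∈ halfPlane) (hw : w ∈ ball z (z.im / 2)) :
    (2 : ℝ) ^ (-|lam - 2|) * z.im ^ (lam - 2) ≤ weight lam w := by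
  have hy : 0 < z.im := hz
  have h1 : |w.im - z.im| < z.im / 2 := by
    rw [← Complex.sub_im]
    exact (Complex.abs_im_le_norm _).trans_lt (mem_ball_iff_norm.1 hw)
  rw [abs_lt] at h1
  have h2 : weight lam w = (w.im / z.im) ^ (lam - 2) * z.im ^ (lam - 2) := by
    rw [weight, ← Real.mul_rpow (div_nonneg (by linarith) hy.le) hy.le, div_mul_cancel₀ _ hy.ne']
  rw [h2]
  gcongr
  refine rpow_neg_abs_le_rpow ?_ ?_
  · rw [le_div_iff₀ hy]; linarith
  · rw [div_le_iff₀ hy]; linarith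

theorem ball_subset_halfPlane {z : ℂ} : ball z (z.im / 2) ⊆ halfPlane := by
  intro w hw
  have h1 : |w.im - z.im| < z.im / 2 := by
    rw [← Complex.sub_im]
    exact (Complex.abs_im_le_norm _).trans_lt (mem_ball_iff_norm.1 hw)
  rw [abs_lt] at h1
  have h2 : 0 < z.im / 2 := (abs_nonneg _).trans_lt (abs_lt.2 h1)
  show 0 < w.im
  linarith

theorem isOpen_halfPlane : IsOpen halfPlane := UpperHalfPlane.isOpen_upperHalfPlaneSet

/-- The integral of `|f|²` against the weight over the bidisc of radius `y / 2` around the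
diagonal point `(z, z)`. -/
def localMass (lam mu : ℝ) (f : ℂ × ℂ → ℂ) (z : ℂ) : ℝ≥0∞ :=
  ∫⁻ x in ball (z, z) (z.im / 2), ENNReal.ofReal (weight₂ lam mu x) * ‖f x‖ₑ ^ 2

theorem localMass_le {lam mu : ℝ} (f : H2Prod lam mu) (z : ℂ) :
    localMass lam mu f z ≤ ‖f‖ₑ ^ 2 := by
  rw [enorm_sq_eq_lintegral]
  refine lintegral_mono_set ?_
  rw [← ball_prod_same]
  exact prod_mono ball_subset_halfPlane ball_subset_halfPlane

/-- Scaling fixes the powers of y. The weight gives y^(lam + mu - 4) and the real four-dimensional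
volume gives y^4, so |f|² is at most a constant times y^(-(lam + mu)) times the local mass; Cauchy's
estimate then costs y^(-2(m + n)). -/
theorem exists_local_mixedDeriv_bound (lam mu : ℝ) (m n : ℕ) :
    ∃ K : ℝ, 0 ≤ K ∧ ∀ f : H2Prod lam mu, ∀ z ∈ halfPlane,
      z.im ^ (lam + mu + 2 * (m + n : ℕ) - 2) * ‖mixedDeriv m n f (z, z)‖ ^ 2 ≤
        K * z.im ^ (-2 : ℝ) * (localMass lam mu f z).toReal := by
  set V : ℝ := (volume (ball (0 : ℂ × ℂ) 1)).toReal with hV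
  have hV0 : 0 < V := ENNReal.toReal_pos (measure_ball_pos _ _ one_pos).ne'
    measure_ball_lt_top.ne
  set κ : ℝ := (2 : ℝ) ^ (-|lam - 2|) * 2 ^ (-|mu - 2|) with hκ
  have hκ0 : 0 < κ := by positivity
  refine ⟨(m ! * n ! * 8 ^ (m + n)) ^ 2 * (256 / (V * κ)), by positivity, fun f z hz => ?_⟩
  have hy : 0 < z.im := hz
  set y := z.im with hydef
  set J := localMass lam mu f z with hJ
  have hJt : J ≠ ∞ := ((localMass_le f z).trans_lt (by simp)).ne
  set W : ℝ := κ * y ^ (lam + mu - 4) with hW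
  have hW0 : 0 < W := by positivity
  have hbs : ball ((z, z) : ℂ × ℂ) (y / 2) ⊆ halfPlane ×ˢ halfPlane := by
    rw [← ball_prod_same]
    exact prod_mono ball_subset_halfPlane ball_subset_halfPlane
  have hIJ : ENNReal.ofReal W * ∫⁻ x in ball (z, z) (y / 2), ‖f x‖ₑ ^ 2 ≤ J := by
    rw [← lintegral_const_mul' _ _ ENNReal.ofReal_ne_top]
    refine setLIntegral_mono' measurableSet_ball fun x hx => ?_
    gcongr
    rw [← ball_prod_same] at hx
    have h1 := weight_ge (lam := lam) hz hx.1
    have h2 := weight_ge (lam := mu) hz hx.2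
    calc W = ((2 : ℝ) ^ (-|lam - 2|) * y ^ (lam - 2)) * (2 ^ (-|mu - 2|) * y ^ (mu - 2)) := by
          rw [hW, hκ, show lam + mu - 4 = (lam - 2) + (mu - 2) by ring, Real.rpow_add hy]; ring
      _ ≤ weight₂ lam mu x := mul_le_mul h1 h2 (by positivity) (le_trans (by positivity) h1)
  -- Here 256 = 4^4 comes from the volume of a bidisc of radius y/4.
  set B : ℝ := 256 / (V * κ) * y ^ (-(lam + mu)) * J.toReal with hB
  have hB0 : 0 ≤ B := by positivity
  -- Cauchy's estimate uses radius y/8 and the sub-mean value property radius y/4; together they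
  -- remain below y/2.
  have hpt : ∀ x ∈ closedBall ((z, z) : ℂ × ℂ) (y / 8), ‖f x‖ ≤ Real.sqrt B := by
    intro x hx
    have hsub : ball x (y / 4) ⊆ ball (z, z) (y / 2) := by
      intro u hu
      have h1 : dist u x < y / 4 := hu
      have h2 : dist x (z, z) ≤ y / 8 := hx
      have := dist_triangle u x (z, z)
      simp only [mem_ball]; linarith
    have h1 := volume_mul_sq_le
      (IsWeight.rot (halfPlane ×ˢ halfPlane) (weight₂ lam mu))
      (f.2.1.mono (hsub.trans hbs))
    have h2 : ENNReal.ofReal W * (volume (ball (0 : ℂ × ℂ) (y / 4)) * ‖f x‖ₑ ^ 2) ≤ J :=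
      le_trans (by gcongr; exact h1.trans (lintegral_mono_set hsub)) hIJ
    have h3 := ENNReal.toReal_mono hJt h2
    rw [Measure.addHaar_ball _ _ (by positivity)] at h3
    simp only [ENNReal.toReal_mul, ENNReal.toReal_pow, toReal_enorm] at h3
    rw [← hV, ENNReal.toReal_ofReal hW0.le, ENNReal.toReal_ofReal (by positivity)] at h3
    have hfr : Module.finrank ℝ (ℂ × ℂ) = 4 := by
      rw [Module.finrank_prod, Complex.finrank_real_complex]
    rw [hfr] at h3
    refine Real.le_sqrt_of_sq_le ?_
    have hyp : y ^ (lam + mu - 4) * y ^ 4 * y ^ (-(lam + mu)) = 1 := by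
      rw [← Real.rpow_natCast, ← Real.rpow_add hy, ← Real.rpow_add hy]
      norm_num
    have h4 : ‖f x‖ ^ 2 = 256 / (V * κ) * y ^ (-(lam + mu)) *
        (W * ((y / 4) ^ 4 * V * ‖f x‖ ^ 2)) := by
      have : 256 / (V * κ) * y ^ (-(lam + mu)) * (W * ((y / 4) ^ 4 * V * ‖f x‖ ^ 2)) =
          (y ^ (lam + mu - 4) * y ^ 4 * y ^ (-(lam + mu))) * ‖f x‖ ^ 2 := by
        rw [hW]; field_simp; norm_num
      rw [this, hyp, one_mul]
    rw [h4, hB]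
    gcongr
  have hD := norm_mixedDeriv_le (w := ((z, z) : ℂ × ℂ)) (r := y / 8) (R := y / 2)
    (by positivity) (by linarith) (f.2.1.mono hbs) hpt m n
  have hD2 : ‖mixedDeriv m n f (z, z)‖ ^ 2 ≤
      (m ! * n ! * 8 ^ (m + n)) ^ 2 * (y ^ (2 * (m + n)))⁻¹ * B := by
    calc ‖mixedDeriv m n f (z, z)‖ ^ 2
        ≤ (m ! * (n ! * Real.sqrt B / (y / 8) ^ n) / (y / 8) ^ m) ^ 2 := by gcongr
      _ = (m ! * n ! * 8 ^ (m + n)) ^ 2 * (y ^ (2 * (m + n)))⁻¹ * Real.sqrt B ^ 2 := by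
          have h8 : (8 : ℝ) ^ (m + n) = 8 ^ m * 8 ^ n := pow_add _ _ _
          have hyy : y ^ (2 * (m + n)) = (y ^ m * y ^ n) ^ 2 := by ring
          simp only [div_pow, h8, hyy]
          field_simp
      _ = _ := by rw [Real.sq_sqrt hB0]
  have hyp : y ^ (lam + mu + 2 * (m + n : ℕ) - 2) * (y ^ (2 * (m + n)))⁻¹ * y ^ (-(lam + mu))
      = y ^ (-2 : ℝ) := by
    rw [← Real.rpow_natCast, ← Real.rpow_neg hy.le, ← Real.rpow_add hy, ← Real.rpow_add hy]
    congr 1; push_cast; ring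
  calc y ^ (lam + mu + 2 * (m + n : ℕ) - 2) * ‖mixedDeriv m n f (z, z)‖ ^ 2
      ≤ y ^ (lam + mu + 2 * (m + n : ℕ) - 2) *
        ((m ! * n ! * 8 ^ (m + n)) ^ 2 * (y ^ (2 * (m + n)))⁻¹ * B) := by gcongr
    _ = (m ! * n ! * 8 ^ (m + n)) ^ 2 * (256 / (V * κ)) *
        (y ^ (lam + mu + 2 * (m + n : ℕ) - 2) * (y ^ (2 * (m + n)))⁻¹ * y ^ (-(lam + mu))) *
          J.toReal := by rw [hB]; ring
    _ = _ := by rw [hyp]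

/-- The points `z` with `x ∈ ball z (y / 2)` have bounded hyperbolic area. -/
theorem lintegral_inv_sq_le {x : ℂ} (hx : x ∈ halfPlane) :
    ∫⁻ z in {z | z ∈ halfPlane ∧ x ∈ ball z (z.im / 2)}, ENNReal.ofReal (z.im ^ (-2 : ℝ)) ≤
      ENNReal.ofReal (9 / 4) * NNReal.pi := by
  have hx0 : 0 < x.im := hx
  have hms : MeasurableSet {z : ℂ | z ∈ halfPlane ∧ x ∈ ball z (z.im / 2)} := by
    refine isOpen_halfPlane.measurableSet.inter (measurableSet_lt ?_ ?_)
    · exact measurable_const.dist measurable_id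
    · exact Complex.measurable_im.div_const 2
  have him : ∀ z : ℂ, x ∈ ball z (z.im / 2) → |x.im - z.im| < z.im / 2 := fun z h => by
    rw [← Complex.sub_im]
    exact (Complex.abs_im_le_norm _).trans_lt (mem_ball_iff_norm.1 h)
  calc ∫⁻ z in {z | z ∈ halfPlane ∧ x ∈ ball z (z.im / 2)}, ENNReal.ofReal (z.im ^ (-2 : ℝ))
      -- The condition on z forces 2/3 Im x < Im z < 2 Im x. The lower bound gives the factor 9/4,
      -- the upper one puts z in the disc of radius Im x about x.
      ≤ ∫⁻ z in {z | z ∈ halfPlane ∧ x ∈ ball z (z.im / 2)},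
          ENNReal.ofReal (9 / 4 * (x.im ^ 2)⁻¹) := by
        refine setLIntegral_mono' hms fun z hz => ENNReal.ofReal_le_ofReal ?_
        have hz0 : 0 < z.im := hz.1
        have h1 := him z hz.2
        rw [abs_lt] at h1
        rw [Real.rpow_neg hz0.le, Real.rpow_two, ← div_eq_mul_inv, le_div_iff₀ (by positivity),
          inv_mul_le_iff₀ (by positivity)]
        nlinarith
    _ ≤ ENNReal.ofReal (9 / 4 * (x.im ^ 2)⁻¹) * volume (ball x x.im) := by
        rw [setLIntegral_const]
        gcongr
        intro z hz
        have h1 := him z hz.2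
        rw [abs_lt] at h1
        have h2 : dist x z < z.im / 2 := hz.2
        rw [mem_ball, dist_comm]
        linarith
    _ = ENNReal.ofReal (9 / 4) * NNReal.pi := by
        rw [Complex.volume_ball, ENNReal.ofReal_mul (by norm_num), mul_assoc, ← mul_assoc _ _
          (NNReal.pi : ℝ≥0∞), ← ENNReal.ofReal_pow hx0.le, ← ENNReal.ofReal_mul (by positivity),
          inv_mul_cancel₀ (by positivity), ENNReal.ofReal_one, one_mul]

/-- Tonelli: the mass at x is counted once for each z whose bidisc contains x, and keeping only the
condition on x₁ already leaves a set of bounded hyperbolic area. -/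
theorem lintegral_localMass_le {lam mu : ℝ} (f : H2Prod lam mu) :
    ∫⁻ z in halfPlane, ENNReal.ofReal (z.im ^ (-2 : ℝ)) * localMass lam mu f z ≤
      ENNReal.ofReal (9 / 4) * NNReal.pi * ‖f‖ₑ ^ 2 := by
  set G : ℂ × ℂ → ℝ≥0∞ := fun x => ENNReal.ofReal (weight₂ lam mu x) * ‖f x‖ₑ ^ 2 with hG
  have hwm : ∀ s : ℝ, Measurable (weight s) := fun s => Complex.measurable_im.pow_const _
  have hGm : Measurable G := by
    refine Measurable.mul ?_ ((measurable_coe f).enorm.pow_const 2)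
    exact (((hwm lam).comp measurable_fst).mul ((hwm mu).comp measurable_snd)).ennreal_ofReal
  have hU : MeasurableSet (halfPlane ×ˢ halfPlane) :=
    (isOpen_halfPlane.prod isOpen_halfPlane).measurableSet
  set S : Set (ℂ × (ℂ × ℂ)) := {p | p.1 ∈ halfPlane ∧ p.2 ∈ ball (p.1, p.1) (p.1.im / 2)} with hS
  have hSm : MeasurableSet S := by
    refine (isOpen_halfPlane.measurableSet.preimage measurable_fst).inter (measurableSet_lt ?_ ?_)
    · exact measurable_snd.dist (measurable_fst.prodMk measurable_fst)
    · exact (Complex.measurable_im.comp measurable_fst).div_const 2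
  set H : ℂ → ℂ × ℂ → ℝ≥0∞ := fun z x =>
    S.indicator (fun p => ENNReal.ofReal (p.1.im ^ (-2 : ℝ)) * G p.2) (z, x) with hH
  have hHm : Measurable (Function.uncurry H) := by
    refine Measurable.indicator ?_ hSm
    exact ((Complex.measurable_im.comp measurable_fst).pow_const _).ennreal_ofReal.mul
      (hGm.comp measurable_snd)
  have hin : ∀ z x, (z, x) ∈ S → H z x = ENNReal.ofReal (z.im ^ (-2 : ℝ)) * G x :=
    fun z x h => indicator_of_mem h _
  have hout : ∀ z x, (z, x) ∉ S → H z x = 0 := fun z x h => indicator_of_notMem h _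
  have h1 : ∫⁻ z in halfPlane, ENNReal.ofReal (z.im ^ (-2 : ℝ)) * localMass lam mu f z =
      ∫⁻ z, ∫⁻ x, H z x := by
    rw [← lintegral_indicator isOpen_halfPlane.measurableSet]
    refine lintegral_congr fun z => ?_
    by_cases hz : z ∈ halfPlane
    · rw [indicator_of_mem hz, localMass, ← lintegral_const_mul' _ _ ENNReal.ofReal_ne_top,
        ← lintegral_indicator measurableSet_ball]
      refine lintegral_congr fun x => ?_
      by_cases hx : x ∈ ball (z, z) (z.im / 2)
      · rw [indicator_of_mem hx, hin z x ⟨hz, hx⟩]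
      · rw [indicator_of_notMem hx, hout z x fun h => hx h.2]
    · rw [indicator_of_notMem hz]
      exact ((lintegral_congr fun x => hout z x fun h => hz h.1).trans lintegral_zero).symm
  rw [h1, lintegral_lintegral_swap hHm.aemeasurable, enorm_sq_eq_lintegral,
    ← lintegral_const_mul' _ _ (ENNReal.mul_ne_top ENNReal.ofReal_ne_top ENNReal.coe_ne_top),
    ← lintegral_indicator hU]
  refine lintegral_mono fun x => ?_
  by_cases hx : x ∈ halfPlane ×ˢ halfPlane
  · rw [indicator_of_mem hx]
    have hT : MeasurableSet {z : ℂ | z ∈ halfPlane ∧ x.1 ∈ ball z (z.im / 2)} := by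
      refine isOpen_halfPlane.measurableSet.inter (measurableSet_lt ?_ ?_)
      · exact measurable_const.dist measurable_id
      · exact Complex.measurable_im.div_const 2
    calc ∫⁻ z, H z x
        ≤ ∫⁻ z in {z | z ∈ halfPlane ∧ x.1 ∈ ball z (z.im / 2)},
            ENNReal.ofReal (z.im ^ (-2 : ℝ)) * G x := by
          rw [← lintegral_indicator hT]
          refine lintegral_mono fun z => ?_
          by_cases hz : (z, x) ∈ S
          · have hz' : z ∈ {z : ℂ | z ∈ halfPlane ∧ x.1 ∈ ball z (z.im / 2)} := by
              refine ⟨hz.1, ?_⟩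
              have h2 := hz.2
              rw [← ball_prod_same] at h2
              exact h2.1
            rw [indicator_of_mem hz', hin z x hz]
          · rw [hout z x hz]
            exact zero_le
      _ = (∫⁻ z in {z | z ∈ halfPlane ∧ x.1 ∈ ball z (z.im / 2)},
            ENNReal.ofReal (z.im ^ (-2 : ℝ))) * G x := by
          refine lintegral_mul_const'' _ ?_
          exact ((Complex.measurable_im.pow_const _).ennreal_ofReal).aemeasurable
      _ ≤ _ := by
          gcongr
          exact lintegral_inv_sq_le hx.1
  · rw [indicator_of_notMem hx]
    have hGx : G x = 0 := by simp [hG, f.2.2.1 x hx]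
    refine ((lintegral_congr fun z => ?_).trans lintegral_zero).le
    by_cases hz : (z, x) ∈ S
    · rw [hin z x hz, hGx, mul_zero]
    · exact hout z x hz

/-- The restriction of a mixed derivative to the diagonal, extended by zero. -/
def diagDeriv (m n : ℕ) (f : ℂ × ℂ → ℂ) : ℂ → ℂ :=
  halfPlane.indicator fun z => mixedDeriv m n f (z, z)

/-- Restriction to the diagonal is where joint, not merely separate, differentiability of the mixed
derivative is used. -/
theorem differentiableOn_diagDeriv (m n : ℕ) {f : ℂ × ℂ → ℂ}
    (hf : DifferentiableOn ℂ f (halfPlane ×ˢ halfPlane)) :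
    DifferentiableOn ℂ (diagDeriv m n f) halfPlane := by
  have h1 := differentiableOn_mixedDeriv isOpen_halfPlane isOpen_halfPlane hf m n
  have h2 : DifferentiableOn ℂ (fun z : ℂ => (z, z)) halfPlane :=
    (differentiable_id.prodMk differentiable_id).differentiableOn
  exact (h1.comp h2 fun z hz => mk_mem_prod hz hz).congr fun z hz => indicator_of_mem hz _

theorem exists_diagDeriv_bound (lam mu : ℝ) (m n : ℕ) :
    ∃ M : ℝ, 0 ≤ M ∧ ∀ f : H2Prod lam mu,
      eLpNorm (diagDeriv m n f) 2
        (weightMeasure halfPlane (weight (lam + mu + 2 * (m + n : ℕ)))) ≤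
          ENNReal.ofReal M * ‖f‖ₑ := by
  obtain ⟨K, hK, h⟩ := exists_local_mixedDeriv_bound lam mu m n
  set Q : ℝ := K * (9 / 4 * Real.pi) with hQ
  have hQ0 : 0 ≤ Q := by positivity
  refine ⟨Real.sqrt Q, Real.sqrt_nonneg _, fun f => ?_⟩
  rw [← ENNReal.pow_le_pow_left_iff two_ne_zero, eLpNorm_two_sq, lintegral_weightMeasure, mul_pow,
    ← ENNReal.ofReal_pow (Real.sqrt_nonneg _), Real.sq_sqrt hQ0]
  calc ∫⁻ z in halfPlane, ENNReal.ofReal (weight (lam + mu + 2 * (m + n : ℕ)) z) *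
        ‖diagDeriv m n f z‖ₑ ^ 2
      ≤ ∫⁻ z in halfPlane, ENNReal.ofReal K *
          (ENNReal.ofReal (z.im ^ (-2 : ℝ)) * localMass lam mu f z) := by
        refine setLIntegral_mono' isOpen_halfPlane.measurableSet fun z hz => ?_
        have hz0 : 0 < z.im := hz
        have hJt : localMass lam mu f z ≠ ∞ := ((localMass_le f z).trans_lt (by simp)).ne
        have h1 := ENNReal.ofReal_le_ofReal (h f z hz)
        rw [ENNReal.ofReal_mul (by positivity), ENNReal.ofReal_mul (by positivity),
          ENNReal.ofReal_mul hK, ENNReal.ofReal_toReal hJt, ENNReal.ofReal_pow (norm_nonneg _),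
          ofReal_norm, mul_assoc] at h1
        rw [diagDeriv, indicator_of_mem hz]
        exact h1
    _ = ENNReal.ofReal K *
        ∫⁻ z in halfPlane, ENNReal.ofReal (z.im ^ (-2 : ℝ)) * localMass lam mu f z :=
        lintegral_const_mul' _ _ ENNReal.ofReal_ne_top
    _ ≤ ENNReal.ofReal K * (ENNReal.ofReal (9 / 4) * NNReal.pi * ‖f‖ₑ ^ 2) := by
        gcongr
        exact lintegral_localMass_le f
    _ = ENNReal.ofReal Q * ‖f‖ₑ ^ 2 := by
        have hpi : (NNReal.pi : ℝ≥0∞) = ENNReal.ofReal Real.pi := by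
          rw [← NNReal.coe_real_pi, ENNReal.ofReal_coe_nnreal]
        rw [hpi, hQ, ENNReal.ofReal_mul hK, ENNReal.ofReal_mul (by norm_num)]
        ring

/-- The restriction of mixed derivatives to the diagonal is a bounded operator between the
Bergman spaces. -/
theorem exists_diagDeriv_clm (lam mu nu : ℝ) (m n : ℕ) (h : nu = lam + mu + 2 * (m + n : ℕ)) :
    ∃ T : H2Prod lam mu →L[ℂ] H2 nu, ∀ f : H2Prod lam mu, (T f).1 = diagDeriv m n f := by
  subst h
  obtain ⟨M, hM, hb⟩ := exists_diagDeriv_bound lam mu m n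
  have hmem : ∀ f : H2Prod lam mu, diagDeriv m n f ∈
      holL2 halfPlane (weight (lam + mu + 2 * (m + n : ℕ))) := by
    intro f
    have hd := differentiableOn_diagDeriv m n f.2.1
    refine ⟨hd, fun z hz => indicator_of_notMem hz _, ?_, ?_⟩
    · classical
      have h1 : Measurable (diagDeriv m n f) := by
        have h2 : diagDeriv m n f = halfPlane.piecewise (diagDeriv m n f) 0 := by
          ext z
          by_cases hz : z ∈ halfPlane
          · rw [piecewise_eq_of_mem _ _ _ hz]
          · rw [piecewise_eq_of_notMem _ _ _ hz, diagDeriv, indicator_of_notMem hz]; rfl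
        rw [h2]
        exact hd.continuousOn.measurable_piecewise continuousOn_const
          isOpen_halfPlane.measurableSet
      exact h1.aestronglyMeasurable
    · exact (hb f).trans_lt (ENNReal.mul_lt_top ENNReal.ofReal_lt_top (by simp))
  let T₀ : H2Prod lam mu →ₗ[ℂ] H2 (lam + mu + 2 * (m + n : ℕ)) :=
    { toFun := fun f => ⟨diagDeriv m n f, hmem f⟩
      map_add' := fun f g => by
        refine Subtype.ext (funext fun z => ?_)
        show diagDeriv m n (f.1 + g.1) z = diagDeriv m n f.1 z + diagDeriv m n g.1 z
        by_cases hz : z ∈ halfPlane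
        · simp only [diagDeriv, indicator_of_mem hz]
          exact mixedDeriv_add isOpen_halfPlane isOpen_halfPlane f.2.1 g.2.1 m n
            (mk_mem_prod hz hz)
        · simp only [diagDeriv, indicator_of_notMem hz, add_zero]
      map_smul' := fun c f => by
        refine Subtype.ext (funext fun z => ?_)
        show diagDeriv m n (c • f.1) z = c * diagDeriv m n f.1 z
        by_cases hz : z ∈ halfPlane
        · simp only [diagDeriv, indicator_of_mem hz, mixedDeriv_smul]
        · simp only [diagDeriv, indicator_of_notMem hz, mul_zero] }
  refine ⟨T₀.mkContinuous M fun f => ?_, fun f => rfl⟩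
  have h1 : ‖T₀ f‖ₑ ≤ ENNReal.ofReal M * ‖f‖ₑ := by
    refine le_trans (le_of_eq ?_) (hb f)
    exact Lp.enorm_toLp (hmem f).2.2
  have h2 := ENNReal.toReal_mono (ENNReal.mul_ne_top ENNReal.ofReal_ne_top (by simp)) h1
  rwa [ENNReal.toReal_mul, toReal_enorm, toReal_enorm, ENNReal.toReal_ofReal hM] at h2

/-- The Rankin-Cohen operator as a bounded operator between the Bergman spaces. -/
theorem exists_rankinCohen_clm (lam mu nu : ℝ) (l : ℕ) (h : nu = lam + mu + 2 * l) :
    ∃ RC : H2Prod lam mu →L[ℂ] H2 nu, ∀ f : H2Prod lam mu, ∀ z ∈ halfPlane,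
      RC f z = rankinCohen lam mu l f z := by
  -- The orders add up to l only for j ≤ l, because the subtraction is truncated; beyond that the
  -- operator is set to zero.
  have hT : ∀ j : ℕ, ∃ T : H2Prod lam mu →L[ℂ] H2 nu, j ∈ Finset.range (l + 1) →
      ∀ f : H2Prod lam mu, (T f).1 = diagDeriv (l - j) j f := by
    intro j
    by_cases hj : j ∈ Finset.range (l + 1)
    · have hj' : l - j + j = l := Nat.sub_add_cancel (Nat.lt_succ_iff.1 (Finset.mem_range.1 hj))
      obtain ⟨T, hT⟩ := exists_diagDeriv_clm lam mu nu (l - j) j (by rw [hj', h])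
      exact ⟨T, fun _ => hT⟩
    · exact ⟨0, fun h => absurd h hj⟩
  choose T hT using hT
  refine ⟨∑ j ∈ Finset.range (l + 1),
    (((-1) ^ j * poch (lam + l - j) j * poch (mu + j) (l - j) / (j ! * (l - j)!) : ℝ) : ℂ) • T j,
    fun f z hz => ?_⟩
  -- Evaluation at z as a linear map, so that it passes through the sum.
  let ev : H2 nu →ₗ[ℂ] ℂ := ⟨⟨fun g => g z, fun _ _ => rfl⟩, fun _ _ => rfl⟩
  have hev : ∀ g : H2 nu, g z = ev g := fun _ => rfl
  rw [hev, _root_.sum_apply, map_sum, rankinCohen, rankinCohenDiff]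
  refine Finset.sum_congr rfl fun j hj => ?_
  rw [_root_.smul_apply, map_smul, smul_eq_mul, ← hev, hT j hj, diagDeriv,
    indicator_of_mem hz]

end Boundedness

/-! ### Radial weights on the unit disc. -/

section Disc

/-- In polar coordinates the integrand has an explicit primitive. For s < 2 it blows up at the
boundary circle, but it is nonnegative and its primitive is continuous up to r = 1, which gives
integrability. -/
theorem integrableOn_ball_rpow {s : ℝ} (hs : 1 < s) :
    IntegrableOn (fun z : ℂ => (1 - ‖z‖ ^ 2) ^ (s - 2)) (ball 0 1) ∧
      ∫ z in ball (0 : ℂ) 1, (1 - ‖z‖ ^ 2) ^ (s - 2) = Real.pi / (s - 1) := by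
  have hs1 : 0 < s - 1 := by linarith
  set g : ℝ → ℝ := fun r => -(1 - r ^ 2) ^ (s - 1) / (2 * (s - 1)) with hg
  set g' : ℝ → ℝ := fun r => r * (1 - r ^ 2) ^ (s - 2) with hg'
  have hc : ContinuousOn g (Icc 0 1) := by
    refine ContinuousOn.div_const (ContinuousOn.neg ?_) _
    exact ContinuousOn.rpow_const (by fun_prop) fun _ _ => Or.inr hs1.le
  have hd : ∀ r ∈ Ioo (0 : ℝ) 1, HasDerivAt g (g' r) r := by
    intro r hr
    have h0 : 0 < 1 - r ^ 2 := by nlinarith [hr.1, hr.2]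
    have h1 : HasDerivAt (fun r : ℝ => 1 - r ^ 2) (-(2 * r)) r := by
      simpa using (hasDerivAt_pow 2 r).const_sub 1
    have h2 := ((h1.rpow_const (p := s - 1) (Or.inl h0.ne')).neg).div_const (2 * (s - 1))
    refine HasDerivAt.congr_deriv (f := g) h2 ?_
    simp only [hg']
    have : s - 1 - 1 = s - 2 := by ring
    rw [this]
    field_simp
  have hnn : ∀ r ∈ Ioo (0 : ℝ) 1, 0 ≤ g' r := by
    intro r hr
    have h0 : 0 < 1 - r ^ 2 := by nlinarith [hr.1, hr.2]
    exact mul_nonneg hr.1.le (Real.rpow_nonneg h0.le _)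
  have hint : IntegrableOn g' (Ioc 0 1) := intervalIntegral.integrableOn_deriv_of_nonneg hc hd hnn
  have hval : ∫ r in (0 : ℝ)..1, g' r = 1 / (2 * (s - 1)) := by
    rw [intervalIntegral.integral_eq_sub_of_hasDerivAt_of_le zero_le_one hc hd
      ((intervalIntegrable_iff_integrableOn_Ioc_of_le zero_le_one).2 hint)]
    simp [hg, Real.zero_rpow hs1.ne', neg_div]
  set ψ : ℝ → ℝ := (Iio 1).indicator fun r => (1 - r ^ 2) ^ (s - 2) with hψ
  have hψz : (fun z : ℂ => ψ ‖z‖) =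
      (ball (0 : ℂ) 1).indicator fun z => (1 - ‖z‖ ^ 2) ^ (s - 2) := by
    ext z
    by_cases hz : ‖z‖ < 1
    · rw [indicator_of_mem (by simpa using hz), hψ, indicator_of_mem (by simpa using hz)]
    · rw [indicator_of_notMem (by simpa using hz), hψ, indicator_of_notMem (by simpa using hz)]
  have hψr : (fun y : ℝ => y ^ (Module.finrank ℝ ℂ - 1) • ψ y) = (Iio 1).indicator g' := by
    ext y
    rw [Complex.finrank_real_complex]
    by_cases hy : y ∈ Iio 1
    · simp [hψ, hg', indicator_of_mem hy]
    · simp [hψ, indicator_of_notMem hy]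
  have hI : Ioi (0 : ℝ) ∩ Iio 1 = Ioo 0 1 := rfl
  constructor
  · rw [← integrable_indicator_iff measurableSet_ball, ← hψz, integrable_fun_norm_addHaar, hψr,
      IntegrableOn, integrable_indicator_iff measurableSet_Iio, IntegrableOn,
      Measure.restrict_restrict measurableSet_Iio, inter_comm, hI]
    exact hint.mono_set Ioo_subset_Ioc_self
  · rw [← integral_indicator measurableSet_ball, ← hψz, integral_fun_norm_addHaar, hψr,
      integral_indicator measurableSet_Iio, Measure.restrict_restrict measurableSet_Iio,
      inter_comm, hI, ← integral_Ioc_eq_integral_Ioo,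
      ← intervalIntegral.integral_of_le zero_le_one, hval, Complex.finrank_real_complex,
      Measure.real, Complex.volume_ball]
    simp
    field_simp

/-- The mean value property of holomorphic functions against a radial weight on the disc. -/
theorem integral_ball_mul_radial {F : ℂ → ℂ} (hF : DifferentiableOn ℂ F (ball 0 1)) (ω : ℝ → ℝ)
    (hint : IntegrableOn (fun z : ℂ => F z * ω ‖z‖) (ball 0 1)) :
    ∫ z in ball (0 : ℂ) 1, F z * ω ‖z‖ = F 0 * ∫ z in ball (0 : ℂ) 1, (ω ‖z‖ : ℂ) := by
  set G : ℂ → ℂ := (ball 0 1).indicator fun z => F z * ω ‖z‖ with hG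
  have hGi : Integrable G := (integrable_indicator_iff measurableSet_ball).2 hint
  set ν : Measure ℝ := volume.restrict (Ioc 0 (2 * Real.pi)) with hν
  have hmp : ∀ θ : ℝ, MeasurePreserving (fun z : ℂ => circleMap 0 1 θ * z) := fun θ =>
    measurePreserving_smul (circleMap 0 1 θ) (by simp)
  have hcm : Continuous (circleMap 0 1) := continuous_circleMap 0 1
  -- Rotating each slice preserves the product measure, so the averaged integrand is integrable and
  -- Fubini applies. The double integral is then evaluated twice: by rotation invariance in z, and
  -- by the mean value property in θ.
  have hskew : MeasurePreserving (fun p : ℝ × ℂ => (p.1, circleMap 0 1 p.1 * p.2))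
      (ν.prod volume) (ν.prod volume) :=
    (MeasurePreserving.id ν).skew_product (g := fun θ z => circleMap 0 1 θ * z)
      (Continuous.measurable (by unfold Function.uncurry; fun_prop))
      (ae_of_all _ fun θ => (hmp θ).map_eq)
  have hprod : Integrable (fun p : ℝ × ℂ => G (circleMap 0 1 p.1 * p.2)) (ν.prod volume) :=
    hskew.integrable_comp_of_integrable (hGi.comp_snd ν)
  have hrot : ∀ θ : ℝ, ∫ z, G (circleMap 0 1 θ * z) = ∫ z, G z := fun θ => by
    have h1 := integral_map (hmp θ).measurable.aemeasurable
      (f := G) (by rw [(hmp θ).map_eq]; exact hGi.aestronglyMeasurable)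
    rw [(hmp θ).map_eq] at h1
    exact h1.symm
  have h1 : ∫ θ, ∫ z, G (circleMap 0 1 θ * z) ∂volume ∂ν = (2 * Real.pi : ℝ) * ∫ z, G z := by
    simp only [hrot]
    rw [integral_const, hν, Measure.real, Measure.restrict_apply_univ, Real.volume_Ioc, sub_zero,
      ENNReal.toReal_ofReal (by positivity), Complex.real_smul]
  have h2 : ∀ z, ∫ θ, G (circleMap 0 1 θ * z) ∂ν =
      (ball (0 : ℂ) 1).indicator (fun z => (2 * Real.pi : ℝ) * (F 0 * ω ‖z‖)) z := by
    intro z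
    have hnorm : ∀ θ : ℝ, ‖circleMap 0 1 θ * z‖ = ‖z‖ := fun θ => by simp
    by_cases hz : z ∈ ball (0 : ℂ) 1
    · have hz' : ‖z‖ < 1 := by simpa using hz
      have hmem : ∀ t : ℂ, ‖t‖ ≤ 1 → t * z ∈ ball (0 : ℂ) 1 := fun t ht => by
        rw [mem_ball_zero_iff, norm_mul]
        nlinarith [norm_nonneg t, norm_nonneg z]
      have havg : Real.circleAverage (fun t : ℂ => F (t * z)) 0 1 = F 0 := by
        have := DiffContOnCl.circleAverage (f := fun t : ℂ => F (t * z)) (c := 0) (R := 1)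
          (DifferentiableOn.diffContOnCl (by
            intro t ht
            rw [closure_ball _ (by simp)] at ht
            have h3 : DifferentiableAt ℂ F (t * z) :=
              hF.differentiableAt (isOpen_ball.mem_nhds (hmem t (by simpa using ht)))
            have h4 : DifferentiableAt ℂ (fun t : ℂ => t * z) t := by fun_prop
            exact (DifferentiableAt.comp t h3 h4).differentiableWithinAt))
        simpa using this
      rw [Real.circleAverage_def, intervalIntegral.integral_of_le (by positivity)] at havg
      rw [indicator_of_mem hz, ← havg]
      have h5 : ∀ θ : ℝ, G (circleMap 0 1 θ * z) = F (circleMap 0 1 θ * z) * ω ‖z‖ := fun θ => by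
        rw [hG, indicator_of_mem (hmem _ (by simp)), hnorm]
      simp only [h5]
      rw [integral_mul_const, Complex.real_smul, ← hν, ← mul_assoc, ← mul_assoc,
        ← Complex.ofReal_mul, mul_inv_cancel₀ (by positivity), Complex.ofReal_one, one_mul]
    · rw [indicator_of_notMem hz]
      have h5 : ∀ θ : ℝ, G (circleMap 0 1 θ * z) = 0 := fun θ => by
        refine indicator_of_notMem ?_ _
        rw [mem_ball_zero_iff, hnorm]
        simpa using hz
      simp only [h5, integral_zero]
  rw [integral_integral_swap hprod] at h1
  simp only [h2] at h1
  rw [integral_indicator measurableSet_ball, integral_const_mul, integral_const_mul,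
    integral_indicator measurableSet_ball] at h1
  have hpi : ((2 * Real.pi : ℝ) : ℂ) ≠ 0 := by
    exact_mod_cast (by positivity : (2 * Real.pi : ℝ) ≠ 0)
  exact (mul_left_cancel₀ hpi h1).symm

end Disc

/-! ### The Cayley transform centred at a point of the half-plane. -/

section Cayley

/-- The Cayley transform mapping the unit disc onto the half-plane and `0` to `w`. -/
def cayley (w ζ : ℂ) : ℂ := (w - conj w * ζ) / (1 - ζ)

variable {w ζ : ℂ}

theorem one_sub_re_pos (hζ : ζ ∈ ball (0 : ℂ) 1) : 0 < (1 - ζ).re := by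
  have h1 : ‖ζ‖ < 1 := by simpa using hζ
  have := Complex.re_le_norm ζ
  simp only [Complex.sub_re, Complex.one_re]
  linarith

theorem one_sub_ne_zero (hζ : ζ ∈ ball (0 : ℂ) 1) : 1 - ζ ≠ 0 := fun h => by
  have := one_sub_re_pos hζ
  rw [h] at this
  simp at this

/-- The height splits into a radial factor and Im w / |1 - ζ|²; the powers of the latter cancel
against the kernel. -/
theorem cayley_im (hζ : ζ ∈ ball (0 : ℂ) 1) :
    (cayley w ζ).im = w.im / ‖1 - ζ‖ ^ 2 * (1 - ‖ζ‖ ^ 2) := by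
  have h0 : Complex.normSq (1 - ζ) ≠ 0 := by
    simpa [Complex.normSq_eq_zero] using one_sub_ne_zero hζ
  rw [cayley, Complex.div_im, ← Complex.normSq_eq_norm_sq, ← Complex.normSq_eq_norm_sq]
  field_simp
  simp only [Complex.normSq_apply, Complex.sub_re, Complex.sub_im, Complex.mul_re, Complex.mul_im,
    Complex.conj_re, Complex.conj_im, Complex.one_re, Complex.one_im]
  ring

theorem cayley_mem (hw : w ∈ halfPlane) (hζ : ζ ∈ ball (0 : ℂ) 1) : cayley w ζ ∈ halfPlane := by
  have hw0 : 0 < w.im := hw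
  have h1 : ‖ζ‖ < 1 := by simpa using hζ
  have h2 : 0 < ‖1 - ζ‖ := norm_pos_iff.2 (one_sub_ne_zero hζ)
  have h3 : 0 < 1 - ‖ζ‖ ^ 2 := by nlinarith [norm_nonneg ζ]
  show 0 < (cayley w ζ).im
  rw [cayley_im hζ]
  positivity

theorem sub_conj_ne_zero (hw : w ∈ halfPlane) {z : ℂ} (hz : z ∈ halfPlane) : z - conj w ≠ 0 := by
  intro h
  have h1 := congrArg Complex.im h
  have hw0 : 0 < w.im := hw
  have hz0 : 0 < z.im := hz
  simp only [Complex.sub_im, Complex.conj_im, Complex.zero_im] at h1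
  linarith

theorem injOn_cayley (hw : w ∈ halfPlane) : InjOn (cayley w) (ball 0 1) := by
  intro a ha b hb hab
  rw [cayley, cayley, div_eq_div_iff (one_sub_ne_zero ha) (one_sub_ne_zero hb)] at hab
  have h1 : (w - conj w) * (a - b) = 0 := by linear_combination hab
  rcases mul_eq_zero.1 h1 with h | h
  · exact absurd h (sub_conj_ne_zero hw hw)
  · exact sub_eq_zero.1 h

theorem image_cayley (hw : w ∈ halfPlane) : cayley w '' ball 0 1 = halfPlane := by
  refine Subset.antisymm (image_subset_iff.2 fun ζ hζ => cayley_mem hw hζ) fun z hz => ?_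
  have h0 := sub_conj_ne_zero hw hz
  have h1 := sub_conj_ne_zero hw hw
  refine ⟨(z - w) / (z - conj w), ?_, ?_⟩
  · rw [mem_ball_zero_iff, norm_div, div_lt_one (norm_pos_iff.2 h0)]
    refine lt_of_pow_lt_pow_left₀ 2 (norm_nonneg _) ?_
    rw [← Complex.normSq_eq_norm_sq, ← Complex.normSq_eq_norm_sq]
    simp only [Complex.normSq_apply, Complex.sub_re, Complex.sub_im, Complex.conj_re,
      Complex.conj_im]
    have hw0 : 0 < w.im := hw
    have hz0 : 0 < z.im := hz
    nlinarith [mul_pos hw0 hz0]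
  · have h2 : 1 - (z - w) / (z - conj w) = (w - conj w) / (z - conj w) := by
      field_simp; ring
    rw [cayley, h2]
    field_simp
    ring

theorem hasDerivAt_cayley (hζ : ζ ∈ ball (0 : ℂ) 1) :
    HasDerivAt (cayley w) ((w - conj w) / (1 - ζ) ^ 2) ζ := by
  have h1 : HasDerivAt (fun ζ : ℂ => w - conj w * ζ) (-conj w) ζ := by
    simpa using ((hasDerivAt_id ζ).const_mul (conj w)).const_sub w
  have h2 : HasDerivAt (fun ζ : ℂ => 1 - ζ) (-1) ζ := by
    simpa using (hasDerivAt_id ζ).const_sub 1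
  refine HasDerivAt.congr_deriv (f := cayley w) (h1.div h2 (one_sub_ne_zero hζ)) ?_
  congr 1
  ring

theorem det_toSpanSingleton_restrictScalars (c : ℂ) :
    ((ContinuousLinearMap.toSpanSingleton ℂ c).restrictScalars ℝ).det = ‖c‖ ^ 2 := by
  simp [ContinuousLinearMap.det, LinearMap.det_restrictScalars, Algebra.norm_complex_eq,
    Complex.normSq_eq_norm_sq]

/-- The real derivative of the Cayley transform. -/
def cayleyDeriv (w ζ : ℂ) : ℂ →L[ℝ] ℂ :=
  (ContinuousLinearMap.toSpanSingleton ℂ ((w - conj w) / (1 - ζ) ^ 2)).restrictScalars ℝ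

theorem hasFDerivWithinAt_cayley (hζ : ζ ∈ ball (0 : ℂ) 1) :
    HasFDerivWithinAt (cayley w) (cayleyDeriv w ζ) (ball 0 1) ζ :=
  ((hasDerivAt_cayley hζ).hasFDerivAt.restrictScalars ℝ).hasFDerivWithinAt

theorem abs_det_cayleyDeriv (hw : w ∈ halfPlane) :
    |(cayleyDeriv w ζ).det| = 4 * (w.im / ‖1 - ζ‖ ^ 2) ^ 2 := by
  have hw0 : 0 < w.im := hw
  rw [cayleyDeriv, det_toSpanSingleton_restrictScalars, abs_of_nonneg (by positivity), norm_div,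
    Complex.sub_conj]
  simp only [norm_mul, norm_pow, Complex.norm_real, Complex.norm_I, mul_one, Real.norm_eq_abs,
    abs_two, abs_of_pos hw0]
  ring

end Cayley

/-! ### The weighted measure in disc coordinates. -/

section WeightMeasure

theorem ae_mem_weightMeasure {E : Type*} [NormedAddCommGroup E] [NormedSpace ℂ E]
    [MeasureSpace E] [BorelSpace E] (U : Set E) (w : E → ℝ) [IsWeight U w] :
    ∀ᵐ z ∂weightMeasure U w, z ∈ U :=
  (withDensity_absolutelyContinuous _ _).ae_le
    (ae_restrict_mem (IsWeight.isOpen w : IsOpen U).measurableSet)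

variable {F : Type*} [NormedAddCommGroup F] [NormedSpace ℝ F]

theorem measurable_weight (lam : ℝ) : Measurable (weight lam) :=
  Complex.measurable_im.pow_const _

theorem toReal_ofReal_weight (lam : ℝ) {z : ℂ} (hz : z ∈ halfPlane) :
    (ENNReal.ofReal (weight lam z)).toReal = weight lam z :=
  ENNReal.toReal_ofReal (Real.rpow_nonneg (le_of_lt hz) _)

theorem integral_weightMeasure (lam : ℝ) (h : ℂ → F) :
    ∫ z, h z ∂weightMeasure halfPlane (weight lam) = ∫ z in halfPlane, weight lam z • h z := by
  rw [weightMeasure, integral_withDensity_eq_integral_toReal_smul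
    (measurable_weight lam).ennreal_ofReal (ae_of_all _ fun _ => ENNReal.ofReal_lt_top)]
  refine setIntegral_congr_fun isOpen_halfPlane.measurableSet fun z hz => ?_
  simp only [toReal_ofReal_weight lam hz]

theorem integrable_weightMeasure_iff (lam : ℝ) (h : ℂ → F) :
    Integrable h (weightMeasure halfPlane (weight lam)) ↔
      IntegrableOn (fun z => weight lam z • h z) halfPlane := by
  rw [weightMeasure, integrable_withDensity_iff_integrable_smul'
    (measurable_weight lam).ennreal_ofReal (ae_of_all _ fun _ => ENNReal.ofReal_lt_top)]
  refine integrableOn_congr_fun (fun z hz => ?_) isOpen_halfPlane.measurableSet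
  simp only [toReal_ofReal_weight lam hz]

/-- The density of the weighted measure in the coordinates of the Cayley transform. -/
def discWeight (lam : ℝ) (w ζ : ℂ) : ℝ := |(cayleyDeriv w ζ).det| * weight lam (cayley w ζ)

theorem integral_weightMeasure_eq_disc (lam : ℝ) {w : ℂ} (hw : w ∈ halfPlane) (h : ℂ → F) :
    ∫ z, h z ∂weightMeasure halfPlane (weight lam) =
      ∫ ζ in ball 0 1, discWeight lam w ζ • h (cayley w ζ) := by
  rw [integral_weightMeasure, ← image_cayley hw,
    integral_image_eq_integral_abs_det_fderiv_smul volume measurableSet_ball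
      (fun ζ hζ => hasFDerivWithinAt_cayley hζ) (injOn_cayley hw)]
  simp only [discWeight, mul_smul]

theorem integrable_weightMeasure_iff_disc (lam : ℝ) {w : ℂ} (hw : w ∈ halfPlane) (h : ℂ → F) :
    Integrable h (weightMeasure halfPlane (weight lam)) ↔
      IntegrableOn (fun ζ => discWeight lam w ζ • h (cayley w ζ)) (ball 0 1) := by
  rw [integrable_weightMeasure_iff, ← image_cayley hw,
    integrableOn_image_iff_integrableOn_abs_det_fderiv_smul volume measurableSet_ball
      (fun ζ hζ => hasFDerivWithinAt_cayley hζ) (injOn_cayley hw)]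
  simp only [discWeight, mul_smul]

/-- The Jacobian supplies two powers of Im w / |1 - ζ|² and the weight the other lam - 2. -/
theorem discWeight_eq (lam : ℝ) {w ζ : ℂ} (hw : w ∈ halfPlane) (hζ : ζ ∈ ball (0 : ℂ) 1) :
    discWeight lam w ζ = 4 * (w.im / ‖1 - ζ‖ ^ 2) ^ lam * (1 - ‖ζ‖ ^ 2) ^ (lam - 2) := by
  have hw0 : 0 < w.im := hw
  have h1 : ‖ζ‖ < 1 := by simpa using hζ
  have h2 : 0 < ‖1 - ζ‖ := norm_pos_iff.2 (one_sub_ne_zero hζ)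
  have h3 : 0 < 1 - ‖ζ‖ ^ 2 := by nlinarith [norm_nonneg ζ]
  have ht : 0 < w.im / ‖1 - ζ‖ ^ 2 := by positivity
  rw [discWeight, abs_det_cayleyDeriv hw, weight, cayley_im hζ, Real.mul_rpow ht.le h3.le]
  have h4 : (w.im / ‖1 - ζ‖ ^ 2) ^ lam =
      (w.im / ‖1 - ζ‖ ^ 2) ^ 2 * (w.im / ‖1 - ζ‖ ^ 2) ^ (lam - 2) := by
    rw [← Real.rpow_two (w.im / ‖1 - ζ‖ ^ 2), ← Real.rpow_add ht]; congr 1; ring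
  rw [h4]
  ring

end WeightMeasure

/-! ### The reproducing formula on the half-plane. -/

section ReproducingKernel

/-- The conjugate of the (unnormalized) reproducing kernel at `w`, as a function of `z`. -/
def powKernel (lam : ℝ) (w z : ℂ) : ℂ := ((w - conj z) / (2 * Complex.I)) ^ (-(lam : ℂ))

theorem ofReal_mul_cpow {r : ℝ} (hr : 0 < r) {u : ℂ} (hu : u ≠ 0) (s : ℂ) :
    ((r : ℂ) * u) ^ s = (r : ℂ) ^ s * u ^ s := by
  have hr' : (r : ℂ) ≠ 0 := by exact_mod_cast hr.ne'
  rw [Complex.cpow_def_of_ne_zero (mul_ne_zero hr' hu), Complex.cpow_def_of_ne_zero hr',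
    Complex.cpow_def_of_ne_zero hu, Complex.log_ofReal_mul hr hu, add_mul, Complex.exp_add,
    Complex.ofReal_log hr.le]

/-- The base becomes a positive number times 1 - ζ, so the principal power splits without a branch
correction. -/
theorem powKernel_cayley (lam : ℝ) {w ζ : ℂ} (hw : w ∈ halfPlane) (hζ : ζ ∈ ball (0 : ℂ) 1) :
    powKernel lam w (cayley w ζ) =
      ((w.im / ‖1 - ζ‖ ^ 2) ^ (-lam) : ℝ) * (1 - ζ) ^ (-(lam : ℂ)) := by
  have hw0 : 0 < w.im := hw
  have h0 := one_sub_ne_zero hζ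
  have h2 : 0 < ‖1 - ζ‖ := norm_pos_iff.2 h0
  have ht : 0 < w.im / ‖1 - ζ‖ ^ 2 := by positivity
  have hbase : (w - conj (cayley w ζ)) / (2 * Complex.I) =
      ((w.im / ‖1 - ζ‖ ^ 2 : ℝ) : ℂ) * (1 - ζ) := by
    have hc : conj (1 - ζ) ≠ 0 := (map_ne_zero _).2 h0
    have hn : ((‖1 - ζ‖ : ℝ) : ℂ) ^ 2 = (1 - ζ) * conj (1 - ζ) := by
      rw [Complex.mul_conj, Complex.normSq_eq_norm_sq]; push_cast; rfl
    have him : (2 * Complex.I) * (w.im : ℂ) = w - conj w := by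
      rw [Complex.sub_conj]; push_cast; ring
    rw [cayley, map_div₀, map_sub, map_mul, Complex.conj_conj, div_eq_iff (by simp)]
    push_cast
    rw [hn]
    have h5 : conj (1 - ζ) = 1 - conj ζ := by simp
    rw [h5] at hc ⊢
    field_simp
    linear_combination (-1) * him
  rw [powKernel, hbase, ofReal_mul_cpow ht h0, ← Complex.ofReal_neg, ← Complex.ofReal_cpow ht.le]

/-- The reproducing formula of the weighted Bergman space of the half-plane. -/
theorem integral_mul_powKernel {lam : ℝ} (hlam : 1 < lam) {w : ℂ} (hw : w ∈ halfPlane) {f : ℂ → ℂ}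
    (hf : DifferentiableOn ℂ f halfPlane)
    (hint : Integrable (fun z => f z * powKernel lam w z)
      (weightMeasure halfPlane (weight lam))) :
    ∫ z, f z * powKernel lam w z ∂weightMeasure halfPlane (weight lam) =
      (4 * Real.pi / (lam - 1) : ℝ) * f w := by
  have hw0 : 0 < w.im := hw
  set F : ℂ → ℂ := fun ζ => f (cayley w ζ) * (1 - ζ) ^ (-(lam : ℂ)) with hF
  set ω : ℝ → ℝ := fun r => 4 * (1 - r ^ 2) ^ (lam - 2) with hω
  have hFd : DifferentiableOn ℂ F (ball 0 1) := by
    intro ζ hζ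
    have h1 : DifferentiableAt ℂ f (cayley w ζ) :=
      hf.differentiableAt (isOpen_halfPlane.mem_nhds (cayley_mem hw hζ))
    have h2 := DifferentiableAt.comp ζ h1 (hasDerivAt_cayley (w := w) hζ).differentiableAt
    have h3 : DifferentiableAt ℂ (fun ζ : ℂ => (1 - ζ) ^ (-(lam : ℂ))) ζ :=
      DifferentiableAt.cpow_const (by fun_prop) (Or.inl (one_sub_re_pos hζ))
    exact (h2.mul h3).differentiableWithinAt
  -- The powers of Im w / |1 - ζ|² in density and kernel cancel, leaving a holomorphic factor times
  -- a radial one.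
  have hpt : ∀ ζ ∈ ball (0 : ℂ) 1,
      discWeight lam w ζ • (f (cayley w ζ) * powKernel lam w (cayley w ζ)) = F ζ * ω ‖ζ‖ := by
    intro ζ hζ
    have h2 : 0 < ‖1 - ζ‖ := norm_pos_iff.2 (one_sub_ne_zero hζ)
    have ht : 0 < w.im / ‖1 - ζ‖ ^ 2 := by positivity
    have h1 : discWeight lam w ζ * (w.im / ‖1 - ζ‖ ^ 2) ^ (-lam) = ω ‖ζ‖ := by
      rw [discWeight_eq lam hw hζ, hω]
      have : (w.im / ‖1 - ζ‖ ^ 2) ^ lam * (w.im / ‖1 - ζ‖ ^ 2) ^ (-lam) = 1 := by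
        rw [← Real.rpow_add ht, add_neg_cancel, Real.rpow_zero]
      linear_combination 4 * (1 - ‖ζ‖ ^ 2) ^ (lam - 2) * this
    rw [powKernel_cayley lam hw hζ, ← h1, hF, Complex.real_smul]
    push_cast
    ring
  rw [integrable_weightMeasure_iff_disc lam hw] at hint
  have hint' : IntegrableOn (fun ζ : ℂ => F ζ * ω ‖ζ‖) (ball 0 1) :=
    (integrableOn_congr_fun hpt measurableSet_ball).1 hint
  have hF0 : F 0 = f w := by simp [hF, cayley]
  have hωi : ∫ z in ball (0 : ℂ) 1, (ω ‖z‖ : ℂ) = (4 * Real.pi / (lam - 1) : ℝ) := by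
    rw [integral_complex_ofReal, hω, integral_const_mul, (integrableOn_ball_rpow hlam).2]
    push_cast; ring
  rw [integral_weightMeasure_eq_disc lam hw, setIntegral_congr_fun measurableSet_ball hpt,
    integral_ball_mul_radial hFd ω hint', hF0, hωi, mul_comm]

theorem measurable_powKernel (lam : ℝ) (w : ℂ) : Measurable (powKernel lam w) := by
  unfold powKernel
  have h : Continuous fun z : ℂ => (w - conj z) / (2 * Complex.I) := by fun_prop
  exact h.measurable.pow_const _

/-- In disc coordinates the squared modulus times the density is a constant multiple of (1 -
|ζ|²)^(lam - 2). -/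
theorem memLp_powKernel {lam : ℝ} (hlam : 1 < lam) {w : ℂ} (hw : w ∈ halfPlane) :
    MemLp (powKernel lam w) 2 (weightMeasure halfPlane (weight lam)) := by
  have hw0 : 0 < w.im := hw
  rw [memLp_two_iff_integrable_sq_norm (measurable_powKernel lam w).aestronglyMeasurable,
    integrable_weightMeasure_iff_disc lam hw]
  refine (integrableOn_congr_fun (fun ζ hζ => ?_) measurableSet_ball).1
    ((integrableOn_ball_rpow hlam).1.const_mul (4 * w.im ^ (-lam)))
  have h2 : 0 < ‖1 - ζ‖ := norm_pos_iff.2 (one_sub_ne_zero hζ)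
  have ht : 0 < w.im / ‖1 - ζ‖ ^ 2 := by positivity
  rw [powKernel_cayley lam hw hζ, discWeight_eq lam hw hζ, norm_mul, ← Complex.ofReal_neg,
    Complex.norm_cpow_real, Complex.norm_real, Real.norm_of_nonneg (by positivity), smul_eq_mul,
    ← Real.mul_rpow ht.le h2.le]
  have h3 : (w.im / ‖1 - ζ‖ ^ 2) ^ lam * ((w.im / ‖1 - ζ‖ ^ 2 * ‖1 - ζ‖) ^ (-lam)) ^ 2 =
      w.im ^ (-lam) := by
    have h4 : ((w.im / ‖1 - ζ‖ ^ 2 * ‖1 - ζ‖) ^ (-lam)) ^ 2 =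
        ((w.im / ‖1 - ζ‖ ^ 2)⁻¹) ^ lam * w.im ^ (-lam) := by
      rw [← Real.rpow_natCast, ← Real.rpow_mul (by positivity), mul_comm (-lam), Real.rpow_mul
        (by positivity), Real.inv_rpow ht.le, ← Real.rpow_neg ht.le,
        ← Real.mul_rpow ht.le hw0.le, Real.rpow_natCast]
      congr 1
      field_simp
    rw [h4, ← mul_assoc, ← Real.mul_rpow ht.le (by positivity), mul_inv_cancel₀ ht.ne',
      Real.one_rpow, one_mul]
  rw [← h3]
  ring

end ReproducingKernel

/-! ### Reproducing kernels on the product. -/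

section Product

instance {E : Type*} [NormedAddCommGroup E] [NormedSpace ℂ E] [MeasureSpace E]
    [SFinite (volume : Measure E)] (U : Set E) (w : E → ℝ) : SFinite (weightMeasure U w) := by
  unfold weightMeasure; infer_instance

theorem weightMeasure_prod (lam mu : ℝ) :
    weightMeasure (halfPlane ×ˢ halfPlane) (weight₂ lam mu) =
      (weightMeasure halfPlane (weight lam)).prod (weightMeasure halfPlane (weight mu)) := by
  rw [weightMeasure, weightMeasure, weightMeasure,
    prod_withDensity (measurable_weight lam).ennreal_ofReal (measurable_weight mu).ennreal_ofReal,
    Measure.prod_restrict, ← Measure.volume_eq_prod]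
  refine withDensity_congr_ae ?_
  filter_upwards [ae_restrict_mem (isOpen_halfPlane.prod isOpen_halfPlane).measurableSet]
    with z hz
  exact ENNReal.ofReal_mul (Real.rpow_nonneg (le_of_lt hz.1) _)

/-- The (unnormalized) reproducing kernel at `w`, as a holomorphic function of `z`. -/
def holoKernel (lam : ℝ) (w z : ℂ) : ℂ := ((z - conj w) / (2 * Complex.I)) ^ (-(lam : ℂ))

theorem kernel_base_re_pos {w z : ℂ} (hw : w ∈ halfPlane) (hz : z ∈ halfPlane) :
    0 < ((z - conj w) / (2 * Complex.I)).re := by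
  have hw0 : 0 < w.im := hw
  have hz0 : 0 < z.im := hz
  have h : ((z - conj w) / (2 * Complex.I)).re = (z.im + w.im) / 2 := by
    rw [Complex.div_re]
    simp [Complex.normSq_apply]
    ring
  rw [h]
  positivity

theorem kernel_base_ne_zero {w z : ℂ} (hw : w ∈ halfPlane) (hz : z ∈ halfPlane) :
    (z - conj w) / (2 * Complex.I) ≠ 0 := fun h => by
  have := kernel_base_re_pos hw hz
  rw [h] at this
  simp at this

/-- The base lies in the right half-plane, off the branch cut, where principal powers commute with
conjugation. -/
theorem conj_holoKernel (lam : ℝ) {w z : ℂ} (hw : w ∈ halfPlane) (hz : z ∈ halfPlane) :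
    conj (holoKernel lam w z) = powKernel lam w z := by
  have h1 : (w - conj z) / (2 * Complex.I) = conj ((z - conj w) / (2 * Complex.I)) := by
    simp only [map_div₀, map_sub, map_mul, Complex.conj_conj, Complex.conj_I]
    rw [div_eq_div_iff (by simp) (by simp)]
    simp only [Complex.conj_ofNat]
    ring
  have h2 : ((z - conj w) / (2 * Complex.I)).arg ≠ Real.pi := by
    have h3 := Complex.abs_arg_lt_pi_div_two_iff.2 (Or.inl (kernel_base_re_pos hw hz))
    have h4 := le_abs_self ((z - conj w) / (2 * Complex.I)).arg
    have := Real.pi_pos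
    intro h5
    linarith
  rw [powKernel, h1, holoKernel, Complex.conj_cpow _ _ h2]
  simp

theorem hasDerivAt_holoKernel (lam : ℝ) {w z : ℂ} (hw : w ∈ halfPlane) (hz : z ∈ halfPlane) :
    HasDerivAt (holoKernel lam w) (-lam / (2 * Complex.I) * holoKernel (lam + 1) w z) z := by
  have h1 : HasDerivAt (fun z : ℂ => (z - conj w) / (2 * Complex.I)) (1 / (2 * Complex.I)) z :=
    ((hasDerivAt_id z).sub_const _).div_const _
  have h2 := h1.cpow_const (c := -(lam : ℂ)) (Or.inl (kernel_base_re_pos hw hz))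
  refine HasDerivAt.congr_deriv (f := holoKernel lam w) h2 ?_
  rw [holoKernel, show -((lam + 1 : ℝ) : ℂ) = -(lam : ℂ) - 1 by push_cast; ring]
  ring

/-- The reproducing kernel of the product, extended by zero. -/
def prodKernel (lam mu : ℝ) (w : ℂ × ℂ) : ℂ × ℂ → ℂ :=
  (halfPlane ×ˢ halfPlane).indicator fun z => holoKernel lam w.1 z.1 * holoKernel mu w.2 z.2

theorem memLp_powKernel_prod {lam mu : ℝ} (hlam : 1 < lam) (hmu : 1 < mu) {w : ℂ × ℂ}
    (hw : w ∈ halfPlane ×ˢ halfPlane) :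
    MemLp (fun z : ℂ × ℂ => powKernel lam w.1 z.1 * powKernel mu w.2 z.2) 2
      (weightMeasure (halfPlane ×ˢ halfPlane) (weight₂ lam mu)) := by
  have h1 := (memLp_two_iff_integrable_sq_norm
    (measurable_powKernel lam w.1).aestronglyMeasurable).1 (memLp_powKernel hlam hw.1)
  have h2 := (memLp_two_iff_integrable_sq_norm
    (measurable_powKernel mu w.2).aestronglyMeasurable).1 (memLp_powKernel hmu hw.2)
  rw [memLp_two_iff_integrable_sq_norm, weightMeasure_prod]
  · simpa only [norm_mul, mul_pow] using h1.mul_prod h2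
  · exact (((measurable_powKernel lam w.1).comp measurable_fst).mul
      ((measurable_powKernel mu w.2).comp measurable_snd)).aestronglyMeasurable

theorem conj_prodKernel {lam mu : ℝ} {w z : ℂ × ℂ} (hw : w ∈ halfPlane ×ˢ halfPlane)
    (hz : z ∈ halfPlane ×ˢ halfPlane) :
    conj (prodKernel lam mu w z) = powKernel lam w.1 z.1 * powKernel mu w.2 z.2 := by
  rw [prodKernel, indicator_of_mem hz, map_mul, conj_holoKernel lam hw.1 hz.1,
    conj_holoKernel mu hw.2 hz.2]

theorem prodKernel_mem {lam mu : ℝ} (hlam : 1 < lam) (hmu : 1 < mu) {w : ℂ × ℂ}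
    (hw : w ∈ halfPlane ×ˢ halfPlane) :
    prodKernel lam mu w ∈ holL2 (halfPlane ×ˢ halfPlane) (weight₂ lam mu) := by
  refine ⟨?_, fun z hz => indicator_of_notMem hz _, ?_⟩
  · intro z hz
    have h1 : DifferentiableAt ℂ (fun z : ℂ × ℂ => holoKernel lam w.1 z.1) z :=
      (hasDerivAt_holoKernel lam hw.1 hz.1).differentiableAt.comp z differentiableAt_fst
    have h2 : DifferentiableAt ℂ (fun z : ℂ × ℂ => holoKernel mu w.2 z.2) z :=
      (hasDerivAt_holoKernel mu hw.2 hz.2).differentiableAt.comp z differentiableAt_snd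
    exact (h1.mul h2).differentiableWithinAt.congr (fun x hx => indicator_of_mem hx _)
      (indicator_of_mem hz _)
  · have h := (memLp_powKernel_prod hlam hmu hw).star
    refine (memLp_congr_ae ?_).1 h
    filter_upwards [ae_mem_weightMeasure (halfPlane ×ˢ halfPlane) (weight₂ lam mu)] with z hz
    rw [Pi.star_apply, ← conj_prodKernel hw hz]
    exact Complex.conj_conj _

/-- The reproducing formula of the weighted Bergman space of the product. -/
theorem integral_mul_powKernel_prod {lam mu : ℝ} (hlam : 1 < lam) (hmu : 1 < mu) {w : ℂ × ℂ}
    (hw : w ∈ halfPlane ×ˢ halfPlane) (h : H2Prod lam mu) :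
    ∫ z, h z * (powKernel lam w.1 z.1 * powKernel mu w.2 z.2)
        ∂weightMeasure (halfPlane ×ˢ halfPlane) (weight₂ lam mu) =
      (4 * Real.pi / (lam - 1) : ℝ) * (4 * Real.pi / (mu - 1) : ℝ) * h w := by
  have hint : Integrable (fun z => h z * (powKernel lam w.1 z.1 * powKernel mu w.2 z.2))
      (weightMeasure (halfPlane ×ˢ halfPlane) (weight₂ lam mu)) :=
    MemLp.integrable_mul h.2.2.2 (memLp_powKernel_prod hlam hmu hw)
  rw [weightMeasure_prod] at hint ⊢
  have hin : ∀ᵐ y ∂weightMeasure halfPlane (weight mu),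
      ∫ x, h (x, y) * (powKernel lam w.1 x * powKernel mu w.2 y)
        ∂weightMeasure halfPlane (weight lam) =
      ((4 * Real.pi / (lam - 1) : ℝ) * h (w.1, y)) * powKernel mu w.2 y := by
    filter_upwards [hint.prod_left_ae, ae_mem_weightMeasure halfPlane (weight mu)] with y hy hyU
    have hr : ∀ x, h (x, y) * (powKernel lam w.1 x * powKernel mu w.2 y) =
        (h (x, y) * powKernel mu w.2 y) * powKernel lam w.1 x := fun x => by ring
    simp only [hr] at hy ⊢
    have hd : DifferentiableOn ℂ (fun x => h (x, y) * powKernel mu w.2 y) halfPlane := by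
      refine DifferentiableOn.mul_const ?_ _
      exact h.2.1.comp (differentiable_id.prodMk (differentiable_const y)).differentiableOn
        fun x hx => mk_mem_prod hx hyU
    rw [integral_mul_powKernel hlam hw.1 hd hy]
    ring
  -- Integrability of this slice comes from Fubini, since the inner integral has just been
  -- identified with it almost everywhere. No square integrability of a single slice of h is needed.
  have hout : Integrable (fun y => ((4 * Real.pi / (lam - 1) : ℝ) * h (w.1, y)) *
      powKernel mu w.2 y) (weightMeasure halfPlane (weight mu)) :=
    (integrable_congr hin).1 hint.integral_prod_right
  have hd : DifferentiableOn ℂ (fun y => ((4 * Real.pi / (lam - 1) : ℝ) : ℂ) * h (w.1, y))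
      halfPlane := by
    refine DifferentiableOn.const_mul ?_ _
    exact h.2.1.comp ((differentiable_const w.1).prodMk differentiable_id).differentiableOn
      fun y hy => mk_mem_prod hw.1 hy
  rw [integral_prod_symm _ hint, integral_congr_ae hin, integral_mul_powKernel hmu hw.2 hd hout]
  ring

end Product

/-! ### The Rankin–Cohen operator on reproducing kernels. -/

section RankinCohenOfKernel

theorem poch_succ (a : ℝ) (n : ℕ) : poch a (n + 1) = poch a n * (a + n) :=
  ascPochhammer_succ_eval n a

theorem poch_add (a : ℝ) (m n : ℕ) : poch a (m + n) = poch a m * poch (a + m) n := by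
  induction n with
  | zero => simp [poch]
  | succ n ih =>
    rw [← add_assoc, poch_succ, ih, poch_succ]
    push_cast
    ring

theorem poch_sub_one_succ (a : ℝ) (n : ℕ) : poch (a - 1) (n + 1) = (a - 1) * poch a n := by
  rw [add_comm, poch_add]
  simp [poch]

theorem poch_pos {a : ℝ} (ha : 0 < a) (n : ℕ) : 0 < poch a n := ascPochhammer_pos n a ha

theorem iteratedDeriv_holoKernel (lam : ℝ) {w z : ℂ} (hw : w ∈ halfPlane) (hz : z ∈ halfPlane)
    (n : ℕ) : iteratedDeriv n (holoKernel lam w) z =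
      (-1 / (2 * Complex.I)) ^ n * poch lam n * holoKernel (lam + n) w z := by
  induction n generalizing z with
  | zero => simp [poch]
  | succ n ih =>
    have h : iteratedDeriv n (holoKernel lam w) =ᶠ[𝓝 z] fun z =>
        (-1 / (2 * Complex.I)) ^ n * poch lam n * holoKernel (lam + n) w z := by
      filter_upwards [isOpen_halfPlane.mem_nhds hz] with x hx using ih hx
    rw [iteratedDeriv_succ, h.deriv_eq,
      ((hasDerivAt_holoKernel (lam + n) hw hz).const_mul _).deriv, poch_succ]
    push_cast
    rw [add_assoc]
    ring

theorem mixedDeriv_prodKernel (lam mu : ℝ) (w : ℂ × ℂ) {z : ℂ} (hz : z ∈ halfPlane)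
    (m n : ℕ) : mixedDeriv m n (prodKernel lam mu w) (z, z) =
      iteratedDeriv m (holoKernel lam w.1) z * iteratedDeriv n (holoKernel mu w.2) z := by
  have h : (fun z₁ => iteratedDeriv n (fun z₂ => prodKernel lam mu w (z₁, z₂)) z) =ᶠ[𝓝 z]
      fun z₁ => holoKernel lam w.1 z₁ * iteratedDeriv n (holoKernel mu w.2) z := by
    filter_upwards [isOpen_halfPlane.mem_nhds hz] with z₁ hz₁
    have h1 : (fun z₂ => prodKernel lam mu w (z₁, z₂)) =ᶠ[𝓝 z]
        fun z₂ => holoKernel lam w.1 z₁ * holoKernel mu w.2 z₂ := by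
      filter_upwards [isOpen_halfPlane.mem_nhds hz] with z₂ hz₂
      have h2 : (z₁, z₂) ∈ (halfPlane ×ˢ halfPlane : Set (ℂ × ℂ)) := mk_mem_prod hz₁ hz₂
      exact indicator_of_mem h2 _
    rw [h1.iteratedDeriv_eq, iteratedDeriv_const_mul_field]
  rw [mixedDeriv, h.iteratedDeriv_eq, iteratedDeriv_mul_const_field]

/-- Brings all terms of the Rankin–Cohen sum to the common exponent, at the price of powers of the
base; these become the monomials of the binomial expansion. -/
theorem holoKernel_add_natCast (lam : ℝ) {w z : ℂ} (hw : w ∈ halfPlane) (hz : z ∈ halfPlane)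
    (m n : ℕ) : holoKernel (lam + m) w z =
      holoKernel (lam + (m + n : ℕ)) w z * ((z - conj w) / (2 * Complex.I)) ^ n := by
  rw [holoKernel, holoKernel, ← Complex.cpow_natCast,
    ← Complex.cpow_add _ _ (kernel_base_ne_zero hw hz)]
  congr 1
  push_cast
  ring

/-- The Rankin-Cohen operator applied to the reproducing kernel. -/
theorem rankinCohen_prodKernel (lam mu : ℝ) (l : ℕ) {w : ℂ × ℂ}
    (hw : w ∈ halfPlane ×ˢ halfPlane) {z : ℂ} (hz : z ∈ halfPlane) :
    rankinCohen lam mu l (prodKernel lam mu w) z =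
      (poch lam l * poch mu l / l ! : ℝ) *
        (-1 / (2 * Complex.I) * ((conj w.1 - conj w.2) / (2 * Complex.I))) ^ l *
        (holoKernel (lam + l) w.1 z * holoKernel (mu + l) w.2 z) := by
  set A : ℂ := (z - conj w.1) / (2 * Complex.I) with hA
  set B : ℂ := (z - conj w.2) / (2 * Complex.I) with hB
  -- The variable z drops out of this difference. Expanding its l-th power matches the sum term by
  -- term, (-A)^j accounting for the alternating sign.
  have hBA : (conj w.1 - conj w.2) / (2 * Complex.I) = -A + B := by rw [hA, hB]; ring
  rw [rankinCohen, rankinCohenDiff, hBA, mul_pow, add_pow, Finset.mul_sum, Finset.mul_sum,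
    Finset.sum_mul]
  refine Finset.sum_congr rfl fun j hj => ?_
  have hjl : j ≤ l := Nat.lt_succ_iff.1 (Finset.mem_range.1 hj)
  obtain ⟨i, rfl⟩ := Nat.exists_eq_add_of_le' hjl
  rw [Nat.add_sub_cancel, mixedDeriv_prodKernel lam mu w hz, iteratedDeriv_holoKernel lam hw.1 hz,
    iteratedDeriv_holoKernel mu hw.2 hz, holoKernel_add_natCast lam hw.1 hz i j,
    holoKernel_add_natCast mu hw.2 hz j i, add_comm j i, ← hA, ← hB]
  -- The operator's coefficient completes the factor produced by differentiation, so the same full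
  -- Pochhammer symbol appears for every j.
  have h1 : poch lam (i + j) = poch lam i * poch (lam + (i + j : ℕ) - j) j := by
    rw [poch_add]; congr 2; push_cast; ring
  have h2 : poch mu (i + j) = poch mu j * poch (mu + j) i := by rw [add_comm, poch_add]
  have h3 : (((i + j).choose j : ℕ) : ℂ) = ((i + j)! : ℂ) / ((j ! : ℂ) * (i ! : ℂ)) := by
    rw [Nat.cast_choose ℂ (Nat.le_add_left j i), Nat.add_sub_cancel]
  rw [h1, h2, h3, neg_pow A]
  have h4 : ((i + j)! : ℂ) ≠ 0 := by exact_mod_cast (i + j).factorial_ne_zero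
  simp only [Complex.ofReal_div, Complex.ofReal_mul, Complex.ofReal_pow, Complex.ofReal_neg,
    Complex.ofReal_one, Complex.ofReal_natCast]
  generalize (-1 / (2 * Complex.I) : ℂ) = q
  generalize ((poch (lam + (i + j : ℕ) - j) j : ℝ) : ℂ) = p₁
  generalize ((poch lam i : ℝ) : ℂ) = p₂
  generalize ((poch (mu + j) i : ℝ) : ℂ) = p₃
  generalize ((poch mu j : ℝ) : ℂ) = p₄
  generalize holoKernel (lam + (i + j : ℕ)) w.1 z = k₁
  generalize holoKernel (mu + (i + j : ℕ)) w.2 z = k₂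
  generalize ((i + j)! : ℂ) = t at h4 ⊢
  generalize (j ! : ℂ) = t₁
  generalize (i ! : ℂ) = t₂
  clear_value A B
  rw [pow_add q, div_eq_mul_inv, div_eq_mul_inv _ t, div_eq_mul_inv t]
  have h7 : t * t⁻¹ = 1 := mul_inv_cancel₀ h4
  generalize (t₁ * t₂)⁻¹ = u
  generalize (-1 : ℂ) ^ j = e
  -- The only relation needed beyond ring identities is that l! cancels against the numerator of the
  -- binomial coefficient.
  linear_combination (-(e * p₁ * p₃ * u * (q ^ i * p₂ * (k₁ * A ^ j) *
    (q ^ j * p₄ * (k₂ * B ^ i))))) * h7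

/-- The two factors 1/(2i) give the 4^l, and reordering w₁ - w₂ as w₂ - w₁ gives the sign (-1)^l of
the theorem. -/
theorem conj_rankinCohen_prodKernel (lam mu : ℝ) (l : ℕ) {w : ℂ × ℂ}
    (hw : w ∈ halfPlane ×ˢ halfPlane) {z : ℂ} (hz : z ∈ halfPlane) :
    conj (rankinCohen lam mu l (prodKernel lam mu w) z) =
      (-1) ^ l * (poch lam l * poch mu l / (l ! * 4 ^ l) : ℝ) * relKernel lam mu l z w.1 w.2 := by
  have h : conj (-1 / (2 * Complex.I) * ((conj w.1 - conj w.2) / (2 * Complex.I))) =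
      -1 * 4⁻¹ * (w.2 - w.1) := by
    simp only [map_mul, map_div₀, map_sub, map_neg, map_one, Complex.conj_conj, Complex.conj_I,
      Complex.conj_ofNat]
    field_simp
    rw [Complex.I_sq]
    ring
  rw [rankinCohen_prodKernel lam mu l hw hz, map_mul, map_mul, map_pow, h, map_mul,
    conj_holoKernel _ hw.1 hz, conj_holoKernel _ hw.2 hz, Complex.conj_ofReal, relKernel,
    powKernel, powKernel, mul_pow, mul_pow]
  push_cast
  rw [inv_pow]
  ring

end RankinCohenOfKernel

/-- The adjoint of a bounded extension of the Rankin-Cohen operator is the integral operator with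
the relative reproducing kernel. -/
theorem adjoint_eq_integral {lam mu nu : ℝ} (hlam : 1 < lam) (hmu : 1 < mu) (l : ℕ)
    {RC : H2Prod lam mu →L[ℂ] H2 nu}
    (hRC : ∀ f : H2Prod lam mu, ∀ z ∈ halfPlane, RC f z = rankinCohen lam mu l f z)
    (g : H2 nu) {w : ℂ × ℂ} (hw : w ∈ halfPlane ×ˢ halfPlane) :
    Integrable (fun z => g z * relKernel lam mu l z w.1 w.2)
        (weightMeasure halfPlane (weight nu)) ∧
      (ContinuousLinearMap.adjoint RC g) w = (-1) ^ l * (relConst lam mu l : ℂ) *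
        ∫ z, g z * relKernel lam mu l z w.1 w.2 ∂weightMeasure halfPlane (weight nu) := by
  let k : H2Prod lam mu := ⟨prodKernel lam mu w, prodKernel_mem hlam hmu hw⟩
  set c : ℂ := (-1) ^ l * (poch lam l * poch mu l / (l ! * 4 ^ l) : ℝ) with hc
  have hpl := poch_pos (zero_lt_one.trans hlam) l
  have hpm := poch_pos (zero_lt_one.trans hmu) l
  have hc0 : c ≠ 0 := by
    refine mul_ne_zero (pow_ne_zero _ (by norm_num)) ?_
    exact_mod_cast (by positivity : poch lam l * poch mu l / (l ! * 4 ^ l) ≠ 0)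
  have hae : ∀ᵐ z ∂weightMeasure halfPlane (weight nu),
      conj (RC k z) * g z = c * (g z * relKernel lam mu l z w.1 w.2) := by
    filter_upwards [ae_mem_weightMeasure halfPlane (weight nu)] with z hz
    rw [hRC k z hz, conj_rankinCohen_prodKernel lam mu l hw hz]
    ring
  have hint : Integrable (fun z => conj (RC k z) * g z) (weightMeasure halfPlane (weight nu)) :=
    MemLp.integrable_mul (RC k).2.2.2.star g.2.2.2
  constructor
  · have h1 := ((integrable_congr hae).1 hint).const_mul c⁻¹
    simpa only [inv_mul_cancel_left₀ hc0] using h1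
  · have h1 : inner ℂ (RC k) g =
        c * ∫ z, g z * relKernel lam mu l z w.1 w.2 ∂weightMeasure halfPlane (weight nu) := by
      rw [inner_eq_integral, integral_congr_ae hae, integral_const_mul]
    -- The inner product is conjugate-linear in its first argument, so pairing with the kernel is
    -- evaluation at w.
    have h2 : inner ℂ k (ContinuousLinearMap.adjoint RC g) =
        (4 * Real.pi / (lam - 1) : ℝ) * (4 * Real.pi / (mu - 1) : ℝ) *
          (ContinuousLinearMap.adjoint RC g) w := by
      rw [inner_eq_integral, ← integral_mul_powKernel_prod hlam hmu hw]
      refine integral_congr_ae ?_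
      filter_upwards [ae_mem_weightMeasure (halfPlane ×ˢ halfPlane) (weight₂ lam mu)] with z hz
      rw [← conj_prodKernel hw hz, mul_comm]
    rw [ContinuousLinearMap.adjoint_inner_right, h1] at h2
    have hl1 : ((lam - 1 : ℝ) : ℂ) ≠ 0 := by exact_mod_cast (sub_pos.2 hlam).ne'
    have hm1 : ((mu - 1 : ℝ) : ℂ) ≠ 0 := by exact_mod_cast (sub_pos.2 hmu).ne'
    have hpi : (Real.pi : ℂ) ≠ 0 := by exact_mod_cast Real.pi_ne_zero
    have hf : (l ! : ℂ) ≠ 0 := by exact_mod_cast l.factorial_ne_zero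
    -- Use (λ - 1)_{l+1} = (λ - 1)(λ)_l and 2^(2l+4) = 16 · 4^l: the stated constant is the one from
    -- RC k_w divided by the two reproducing constants.
    have h3 : (-1) ^ l * (relConst lam mu l : ℂ) =
        ((lam - 1 : ℝ) : ℂ) * ((mu - 1 : ℝ) : ℂ) / (16 * (Real.pi : ℂ) ^ 2) * c := by
      rw [relConst, poch_sub_one_succ, poch_sub_one_succ, hc, pow_add, pow_mul]
      push_cast
      norm_num
      field_simp
    rw [h3, mul_assoc, h2]
    simp only [Complex.ofReal_div, Complex.ofReal_mul, Complex.ofReal_ofNat]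
    field_simp
    norm_num

end Bergman

end

theorem theorem1 (lam₁ lam₂ lam₃ : ℝ) (h₁ : 1 < lam₁) (h₂ : 1 < lam₂) (h₃ : 1 < lam₃)
    (l : ℕ) (hl : (l : ℝ) = (lam₃ - lam₁ - lam₂) / 2) :
    ∃ RC : Bergman.H2Prod lam₁ lam₂ →L[ℂ] Bergman.H2 lam₃,
      (∀ f : Bergman.H2Prod lam₁ lam₂, ∀ z ∈ Bergman.halfPlane,
        RC f z = Bergman.rankinCohen lam₁ lam₂ l f z) ∧
      ∀ g : Bergman.H2 lam₃, ∀ w₁ ∈ Bergman.halfPlane, ∀ w₂ ∈ Bergman.halfPlane,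
        Integrable (fun z => g z * Bergman.relKernel lam₁ lam₂ l z w₁ w₂)
          (Bergman.weightMeasure Bergman.halfPlane (Bergman.weight lam₃)) ∧
        (ContinuousLinearMap.adjoint RC g) (w₁, w₂) =
          (-1) ^ l * (Bergman.relConst lam₁ lam₂ l : ℂ) *
            ∫ z, g z * Bergman.relKernel lam₁ lam₂ l z w₁ w₂
              ∂Bergman.weightMeasure Bergman.halfPlane (Bergman.weight lam₃) := by
  obtain ⟨RC, hRC⟩ := Bergman.exists_rankinCohen_clm lam₁ lam₂ lam₃ l (by rw [hl]; ring)
  exact ⟨RC, hRC, fun g w₁ hw₁ w₂ hw₂ =>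
    Bergman.adjoint_eq_integral h₁ h₂ l hRC g (w := (w₁, w₂)) (mk_mem_prod hw₁ hw₂)⟩
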